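/- Let $\alpha\in(0,1/2]$. For real $\nu>0$, let $S\ge 0$ satisfy $\nu S^2\sim\chi^2_\nu$ (the Gamma distribution with shape $\nu/2$ and rate $1/2$), and let $F_{t_\nu}$ be the c.d.f. of the $t$-distribution with $\nu$ degrees of freedom. For $n\in\mathbb{N}$ and $\vartheta=(\vartheta_1,\dots,\vartheta_n)\in[0,\infty]^n$, consider testing $H_i:\vartheta_i=0$ versus $K_i:\vartheta_i>0$, $i=1,\dots,n$, with the following $p$-values: $p_i=1-F_{t_\nu}(X_i/S)$ with $X_i\sim N(\vartheta_i,1)$ if $\vartheta_i<\infty$, where the $X_i$ and $S$ are independent, and $p_i=0$ if $\vartheta_i=\infty$. The linear step-up procedure at level $\alpha$ rejects the $m$ hypotheses with the smallest $p$-values, where $m=\max\{k\in\{1,\dots,n\}: p_{k:n}\le k\alpha/n\}$ and $p_{1:n}\le\dots\le p_{n:n}$ are the ordered $p$-values (nothing is rejected if there is no such $k$). Let $R_n$ be the number of rejected hypotheses, $V_n$ the number of rejected true hypotheses, and $$\mathrm{FDR}_n=\mathbb{E}\left[\frac{V_n}{R_n\vee 1}\right].$$ In the model D-EX-t$(\zeta_n)$,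 $n_0=n\zeta_n$ of the $n$ hypotheses are true ($\vartheta_i=0$) and all the others are totally false ($\vartheta_i=\infty$). **Theorem.** For every $\nu>0$ there is a number $\mathrm{FDR}_\infty(1)=\mathrm{FDR}_{\infty,\nu}(1)$ such that, in D-EX-t$(\zeta_n)$ with $\nu$ degrees of freedom, $\lim_{n\to\infty}\mathrm{FDR}_n=\mathrm{FDR}_{\infty,\nu}(1)$ for every sequence with $\lim_{n\to\infty}\zeta_n=1$; and $$\lim_{\nu\to\infty}\mathrm{FDR}_{\infty,\nu}(1)=\Phi\left(-\sqrt{-2\ln\alpha}\right),$$ where $\Phi$ is the standard normal c.d.f. -/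

import Mathlib

open MeasureTheory ProbabilityTheory Filter Topology
open scoped ENNReal

noncomputable section

namespace StudentizedFDR

/-- The chi-square distribution with (real) `ν > 0` degrees of freedom, i.e. the Gamma distribution
with shape `ν / 2` and rate `1 / 2`. -/
def chiSquare (ν : ℝ) : Measure ℝ := gammaMeasure (ν / 2) (1 / 2)

/-- The law of the studentizing variable `S ≥ 0`, where `ν S² ∼ χ²_ν`. -/
def lawS (ν : ℝ) : Measure ℝ := (chiSquare ν).map (fun y => √(y / ν))

/-- The central `t`-distribution with `ν` degrees of freedom: the law of `X / S`, where
`X ∼ N(0, 1)` and `S ∼ lawS ν` are independent. -/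
def studentT (ν : ℝ) : Measure ℝ :=
  ((lawS ν).prod (gaussianReal 0 1)).map (fun ω => ω.2 / ω.1)

/-- The joint law of `(S, (X₁, …, Xₙ))`: the variables are independent, `S ∼ lawS ν` and
`Xᵢ ∼ N(ϑᵢ, 1)`. (The value `ϑᵢ = ∞` is allowed; `Xᵢ` is then not used, see `pValue`.) -/
def model (ν : ℝ) {n : ℕ} (ϑ : Fin n → ℝ≥0∞) : Measure (ℝ × (Fin n → ℝ)) :=
  (lawS ν).prod (Measure.pi fun i => gaussianReal (ϑ i).toReal 1)

/-- The `p`-value `pᵢ = 1 - F_{t_ν}(Xᵢ / S)` for `Hᵢ : ϑᵢ = 0` against `Kᵢ : ϑᵢ > 0`, as a function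
of `ω = (S, (X₁, …, Xₙ))`; for a totally false hypothesis, `ϑᵢ = ∞`, it is `0`. -/
def pValue (ν : ℝ) {n : ℕ} (ϑ : Fin n → ℝ≥0∞) (ω : ℝ × (Fin n → ℝ)) (i : Fin n) : ℝ :=
  if ϑ i = ∞ then 0 else 1 - cdf (studentT ν) (ω.2 i / ω.1)

/-- The index `max {k ≤ n | p_{k:n} ≤ k α / n}` (and `0` if there is no such `k ≥ 1`) of the linear
step-up procedure. The `k`-th smallest `p`-value is at most `c` iff at least `k` of the `p`-values
are at most `c`. -/
def lsuIndex (α : ℝ) {n : ℕ} (p : Fin n → ℝ) : ℕ :=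
  ((Finset.range (n + 1)).filter fun k : ℕ =>
    k ≤ (Finset.univ.filter fun i => p i ≤ k * α / n).card).sup id

/-- The set of (indices of) hypotheses rejected by the linear step-up procedure at level `α`. -/
def lsuRejected (α : ℝ) {n : ℕ} (p : Fin n → ℝ) : Finset (Fin n) :=
  Finset.univ.filter fun i => p i ≤ lsuIndex α p * α / n

/-- The set of true null hypotheses. -/
def trueNulls {n : ℕ} (ϑ : Fin n → ℝ≥0∞) : Finset (Fin n) :=
  Finset.univ.filter fun i => ϑ i = 0

/-- The false discovery proportion `Vₙ / (Rₙ ∨ 1)`. -/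
def fdp (α : ℝ) {n : ℕ} (ϑ : Fin n → ℝ≥0∞) (p : Fin n → ℝ) : ℝ :=
  ((lsuRejected α p ∩ trueNulls ϑ).card : ℝ) / (max (lsuRejected α p).card 1 : ℕ)

/-- The false discovery rate `E[Vₙ / (Rₙ ∨ 1)]` of the linear step-up procedure at level `α` in the
jointly studentized model with `ν` degrees of freedom and parameter `ϑ`. -/
def FDR (ν α : ℝ) {n : ℕ} (ϑ : Fin n → ℝ≥0∞) : ℝ :=
  ∫ ω, fdp α ϑ (pValue ν ϑ ω) ∂(model ν ϑ)

/-- The proportion `ζₙ = n₀ / n` of true null hypotheses. -/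
def trueProportion {n : ℕ} (ϑ : Fin n → ℝ≥0∞) : ℝ := ((trueNulls ϑ).card : ℝ) / n

/-- Extreme configurations: every hypothesis is either true or totally false. -/
def IsExtreme {n : ℕ} (ϑ : Fin n → ℝ≥0∞) : Prop := ∀ i, ϑ i = 0 ∨ ϑ i = ∞

/-- `L` is the limiting false discovery rate `FDR_∞(1)` for `ν` degrees of freedom: for every
sequence of extreme configurations, the `n`-th one having `n` hypotheses, whose proportions `ζₙ` of
true hypotheses tend to `1`, the false discovery rates converge to `L`. -/
def IsLimitingFDROne (ν α L : ℝ) : Prop :=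
  ∀ ϑ : (n : ℕ) → Fin n → ℝ≥0∞, (∀ n, IsExtreme (ϑ n)) →
    Tendsto (fun n => trueProportion (ϑ n)) atTop (𝓝 1) →
    Tendsto (fun n => FDR ν α (ϑ n)) atTop (𝓝 L)

end StudentizedFDR

end

namespace StudentizedFDR

noncomputable section

open Set

/-! Condition on `S = s`. The true nulls then have i.i.d. `p`-values, falling below `tTail ν c` with
probability `normTail (c * s)`, and the other hypotheses are a vanishing fraction. Step-up compares
the curve `(tTail ν c, normTail (c * s))` with the line of slope `1 / α`. If the curve exceeds the
line for some `c ≥ 0`, a positive fraction of all hypotheses is rejected, nearly all of them true,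
and the conditional FDR tends to 1 (`tendsto_condFDR_one`). If it stays strictly below, the rejected
fraction tends to 0, and the false discovery proportion is at most `α / n` times the sum of the
reciprocals of the small true `p`-values. Given `S = s` such a reciprocal is integrable, because
`t`-tails dominate a narrower normal tail, so the conditional FDR tends to 0
(`tendsto_condFDR_zero`). Decreasing `s` raises the curve, so the two cases are separated by at most
one value of `s`, which has no mass. Hence the limit is the probability that `S` lies in
`rejectionRegion`.

For large `ν`, write `tTail ν c` as the mean of `normTail (c * S)`. The ratio `normTail (c * t) /
normTail (c * s)` equals `exp (-(c ^ 2 / 2 * (t ^ 2 - s ^ 2)))` up to a factor between `min 1 (s /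
t)` and `max 1 (s / t)`, free of `c`. The mean of the exponential is a Gamma Laplace transform; for
`s ≤ 1` its minimum over `c` is `exp (ν / 2 * (1 - s ^ 2 + log (s ^ 2)))`. At `s ^ 2 = 1 - x / √(ν /
2)` this tends to `exp (-x ^ 2 / 2)`, while the correction factors average to 1
(`mul_normTail_le_tTail`, `exists_tTail_le_mul_normTail`). So the region ends asymptotically where
`exp (-x ^ 2 / 2) = α`, and the normal approximation of `S ^ 2` (`tendsto_integral_lawS`) gives it
probability `Φ(-x)`. -/

/-! ### Normal tails and their ratios -/

/-- The Mills ratio of the standard normal distribution. -/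
def mills (x : ℝ) : ℝ := ∫ u in Ioi (0 : ℝ), Real.exp (-(x * u) - u ^ 2 / 2)

/-- The upper tail of the standard normal distribution. -/
def normTail (x : ℝ) : ℝ := (gaussianReal 0 1).real (Ioi x)

lemma integrable_mills (x : ℝ) : Integrable fun u : ℝ => Real.exp (-(x * u) - u ^ 2 / 2) := by
  have h : Integrable fun u : ℝ => Real.exp (-(u + x) ^ 2 / 2) := by
    have := (integrable_exp_neg_mul_sq (b := 1 / 2) (by norm_num)).comp_add_right x
    refine this.congr (ae_of_all _ fun u => ?_)
    simp only
    congr 1; ring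
  refine (h.const_mul (Real.exp (x ^ 2 / 2))).congr (ae_of_all _ fun u => ?_)
  simp only [← Real.exp_add]
  congr 1; ring

lemma integrable_mills_quadratic {x r : ℝ} (hr : r ≠ 0) :
    Integrable fun u : ℝ => Real.exp (-(x * u) - (r * u) ^ 2 / 2) := by
  have := (integrable_mills (x / r)).comp_mul_left' hr
  refine this.congr (ae_of_all _ fun u => ?_)
  simp only
  congr 1; field_simp

lemma mills_anti {x y : ℝ} (h : x ≤ y) : mills y ≤ mills x := by
  refine setIntegral_mono_on (integrable_mills y).integrableOn (integrable_mills x).integrableOn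
    measurableSet_Ioi fun u hu => Real.exp_le_exp.2 ?_
  have := mul_le_mul_of_nonneg_right h (le_of_lt (mem_Ioi.1 hu))
  linarith

/-- Rescaling `u` by `s / t` in `mills (c * t)` turns the linear term into that of `mills (c * s)`
and only weakens the quadratic one. For `c > 0` this is monotonicity of `x * mills x`. -/
lemma mills_scale {c s t : ℝ} (hs : 0 < s) (hst : s ≤ t) :
    s / t * mills (c * s) ≤ mills (c * t) := by
  have ht : 0 < t := hs.trans_le hst
  have hr : 0 < s / t := div_pos hs ht
  have hr1 : s / t ≤ 1 := (div_le_one ht).2 hst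
  have key := integral_comp_mul_left_Ioi
    (fun u : ℝ => Real.exp (-(c * t * u) - u ^ 2 / 2)) 0 hr
  rw [mul_zero, smul_eq_mul] at key
  have : mills (c * t)
      = s / t * ∫ u in Ioi (0 : ℝ), Real.exp (-(c * s * u) - (s / t * u) ^ 2 / 2) := by
    rw [mills, ← mul_inv_cancel_left₀ hr.ne' (∫ u in Ioi (0 : ℝ), _), ← key]
    congr 2 with u
    congr 2; field_simp
  rw [this]
  refine mul_le_mul_of_nonneg_left ?_ hr.le
  refine setIntegral_mono_on (integrable_mills _).integrableOn
    (integrable_mills_quadratic hr.ne').integrableOn measurableSet_Ioi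
    fun u hu => Real.exp_le_exp.2 ?_
  have : (s / t * u) ^ 2 ≤ u ^ 2 := by
    rw [mul_pow]
    exact mul_le_of_le_one_left (sq_nonneg u) (pow_le_one₀ hr.le hr1)
  linarith

lemma min_mul_mills_le {c s t : ℝ} (hc : 0 ≤ c) (hs : 0 < s) (ht : 0 < t) :
    min 1 (s / t) * mills (c * s) ≤ mills (c * t) := by
  rcases le_total s t with h | h
  · rw [min_eq_right ((div_le_one ht).2 h)]
    exact mills_scale hs h
  · rw [min_eq_left ((one_le_div ht).2 h), one_mul]
    exact mills_anti (mul_le_mul_of_nonneg_left h hc)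

lemma mills_le_max_mul {c s t : ℝ} (hc : 0 ≤ c) (hs : 0 < s) (ht : 0 < t) :
    mills (c * t) ≤ max 1 (s / t) * mills (c * s) := by
  rcases le_total s t with h | h
  · rw [max_eq_left ((div_le_one ht).2 h), one_mul]
    exact mills_anti (mul_le_mul_of_nonneg_left h hc)
  · rw [max_eq_right ((one_le_div ht).2 h)]
    have := mul_le_mul_of_nonneg_left (mills_scale (c := c) ht h) (div_pos hs ht).le
    have e : s / t * (t / s * mills (c * t)) = mills (c * t) := by field_simp
    rwa [e] at this

lemma normTail_eq_integral (x : ℝ) : normTail x = ∫ u in Ioi x, gaussianPDFReal 0 1 u := by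
  rw [normTail, measureReal_def, gaussianReal_apply_eq_integral 0 one_ne_zero,
    ENNReal.toReal_ofReal (integral_nonneg fun u => gaussianPDFReal_nonneg _ _ _)]

lemma normTail_eq_mills (x : ℝ) :
    normTail x = (√(2 * Real.pi))⁻¹ * Real.exp (-x ^ 2 / 2) * mills x := by
  rw [normTail_eq_integral, mills, ← integral_const_mul]
  have := (measurePreserving_add_right volume x).setIntegral_preimage_emb
    (measurableEmbedding_addRight x) (gaussianPDFReal 0 1) (Ioi x)
  rw [← this]
  have e : (fun u : ℝ => u + x) ⁻¹' Ioi x = Ioi 0 := by ext u; simp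
  rw [e]
  congr 1 with u
  simp only [gaussianPDFReal, NNReal.coe_one, mul_one, sub_zero]
  rw [mul_assoc _ (Real.exp _), ← Real.exp_add]
  congr 2; ring

/-- The Gaussian factor is split off exactly and the remaining Mills ratios are compared by a factor
free of `c`. Averaging over `t` therefore leaves an exponential tilt of the law of `S`. -/
lemma min_mul_normTail_le {c s t : ℝ} (hc : 0 ≤ c) (hs : 0 < s) (ht : 0 < t) :
    min 1 (s / t) * Real.exp (-(c ^ 2 / 2 * (t ^ 2 - s ^ 2))) * normTail (c * s)
      ≤ normTail (c * t) := by
  rw [normTail_eq_mills, normTail_eq_mills]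
  have e : Real.exp (-(c * t) ^ 2 / 2)
      = Real.exp (-(c ^ 2 / 2 * (t ^ 2 - s ^ 2))) * Real.exp (-(c * s) ^ 2 / 2) := by
    rw [← Real.exp_add]; congr 1; ring
  rw [e]
  have h := mul_le_mul_of_nonneg_left (min_mul_mills_le hc hs ht)
    (show 0 ≤ (√(2 * Real.pi))⁻¹ * (Real.exp (-(c ^ 2 / 2 * (t ^ 2 - s ^ 2)))
      * Real.exp (-(c * s) ^ 2 / 2)) by positivity)
  refine le_trans (le_of_eq ?_) h
  ring

lemma normTail_le_max_mul {c s t : ℝ} (hc : 0 ≤ c) (hs : 0 < s) (ht : 0 < t) :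
    normTail (c * t)
      ≤ max 1 (s / t) * Real.exp (-(c ^ 2 / 2 * (t ^ 2 - s ^ 2))) * normTail (c * s) := by
  rw [normTail_eq_mills, normTail_eq_mills]
  have e : Real.exp (-(c * t) ^ 2 / 2)
      = Real.exp (-(c ^ 2 / 2 * (t ^ 2 - s ^ 2))) * Real.exp (-(c * s) ^ 2 / 2) := by
    rw [← Real.exp_add]; congr 1; ring
  rw [e]
  have h := mul_le_mul_of_nonneg_left (mills_le_max_mul hc hs ht)
    (show 0 ≤ (√(2 * Real.pi))⁻¹ * (Real.exp (-(c ^ 2 / 2 * (t ^ 2 - s ^ 2)))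
      * Real.exp (-(c * s) ^ 2 / 2)) by positivity)
  refine h.trans (le_of_eq ?_)
  ring

lemma normTail_nonneg (x : ℝ) : 0 ≤ normTail x := measureReal_nonneg

lemma normTail_le_one (x : ℝ) : normTail x ≤ 1 := measureReal_le_one

lemma normTail_sub {x y : ℝ} (h : x ≤ y) :
    normTail x - normTail y = (gaussianReal 0 1).real (Ioc x y) := by
  have : Ioi x = Ioc x y ∪ Ioi y := (Ioc_union_Ioi_eq_Ioi h).symm
  rw [normTail, normTail, this, measureReal_union (Ioc_disjoint_Ioi le_rfl) measurableSet_Ioi]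
  ring

lemma normTail_strictAnti : StrictAnti normTail := by
  intro x y h
  have h1 := normTail_sub h.le
  have h2 : 0 < (gaussianReal 0 1).real (Ioc x y) := by
    rw [measureReal_def, ENNReal.toReal_pos_iff]
    refine ⟨pos_iff_ne_zero.2 fun h0 => ?_, measure_lt_top _ _⟩
    have := gaussianReal_absolutelyContinuous' 0 one_ne_zero h0
    rw [Real.volume_Ioc] at this
    simp only [ENNReal.ofReal_eq_zero, tsub_le_iff_right, zero_add] at this
    linarith
  linarith

lemma normTail_pos (x : ℝ) : 0 < normTail x :=
  (normTail_nonneg (x + 1)).trans_lt (normTail_strictAnti (lt_add_one x))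

lemma continuous_normTail : Continuous normTail := by
  have h : normTail = fun x => normTail 0 - ∫ u in (0 : ℝ)..x, gaussianPDFReal 0 1 u := by
    ext x
    have := intervalIntegral.integral_Ioi_sub_Ioi' (a := 0) (b := x) (μ := volume)
      (f := gaussianPDFReal 0 1) (integrable_gaussianPDFReal 0 1).integrableOn
      (integrable_gaussianPDFReal 0 1).integrableOn
    rw [normTail_eq_integral, normTail_eq_integral]
    linarith
  rw [h]
  exact continuous_const.sub
    (intervalIntegral.continuous_primitive (fun a b =>
      (integrable_gaussianPDFReal 0 1).intervalIntegrable) 0)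

lemma normTail_zero : normTail 0 = 1 / 2 := by
  have h1 : (gaussianReal 0 1).real (Iio 0) = normTail 0 := by
    have := gaussianReal_map_neg (μ := 0) (v := 1)
    rw [neg_zero] at this
    rw [normTail, ← this, map_measureReal_apply measurable_neg measurableSet_Iio, this]
    congr 1; ext x; simp
  have := nullSingletonClass_gaussianReal (μ := 0) (v := 1) one_ne_zero
  have h2 : (gaussianReal 0 1).real (Iic 0) = normTail 0 := by
    rw [← h1, measureReal_def, measureReal_def, measure_congr Iio_ae_eq_Iic]
  have h3 := probReal_add_probReal_compl (μ := gaussianReal 0 1) (measurableSet_Ioi (a := (0 : ℝ)))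
  rw [compl_Ioi, h2] at h3
  change normTail 0 + _ = 1 at h3
  linarith

lemma measureReal_Ici (x : ℝ) : (gaussianReal 0 1).real (Ici x) = normTail x := by
  have := nullSingletonClass_gaussianReal (μ := 0) (v := 1) one_ne_zero
  rw [normTail, measureReal_def, measureReal_def, measure_congr Ioi_ae_eq_Ici]

/-- The reciprocal grows like `exp (x ^ 2 / 8)` up to lower-order terms, which the Gaussian density
beats. Shrinking the argument is essential: the density over `normTail |x|` grows linearly. -/
lemma integrable_inv_normTail_half :
    Integrable (fun x : ℝ => (normTail (|x| / 2))⁻¹) (gaussianReal 0 1) := by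
  have hlow : ∀ y : ℝ, 0 ≤ y → gaussianPDFReal 0 1 (y + 1) ≤ normTail y := by
    intro y hy
    rw [normTail_eq_integral]
    calc gaussianPDFReal 0 1 (y + 1) = ∫ _ in Ioc y (y + 1), gaussianPDFReal 0 1 (y + 1) := by
          simp [measureReal_def]
      _ ≤ ∫ u in Ioc y (y + 1), gaussianPDFReal 0 1 u := by
          refine setIntegral_mono_on (by simp) (integrable_gaussianPDFReal 0 1).integrableOn
            measurableSet_Ioc fun u hu => ?_
          simp only [gaussianPDFReal, NNReal.coe_one, mul_one, sub_zero]
          refine mul_le_mul_of_nonneg_left (Real.exp_le_exp.2 ?_) (by positivity)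
          have : u ^ 2 ≤ (y + 1) ^ 2 := pow_le_pow_left₀ (hy.trans hu.1.le) hu.2 2
          linarith
      _ ≤ _ := setIntegral_mono_set (integrable_gaussianPDFReal 0 1).integrableOn
          (ae_of_all _ fun u => gaussianPDFReal_nonneg _ _ _)
          (LE.le.eventuallyLE Ioc_subset_Ioi_self)
  have hdom : Integrable (fun x : ℝ => √(2 * Real.pi) * Real.exp 1 *
      (Real.exp (1 * x) + Real.exp (-1 * x)) * Real.exp (x ^ 2 / 8)) (gaussianReal 0 1) := by
    rw [gaussianReal_of_var_ne_zero _ one_ne_zero, integrable_withDensity_iff_integrable_smul'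
      (measurable_gaussianPDF _ _) (ae_of_all _ fun _ => gaussianPDF_lt_top)]
    -- The exponent `-3 / 8` is `1 / 8 - 1 / 2`; completing the square centres at `4 / 3 * b`.
    have hg : ∀ b : ℝ, Integrable fun x : ℝ => Real.exp (b * x) * Real.exp (-3 / 8 * x ^ 2) := by
      intro b
      have := (integrable_exp_neg_mul_sq (b := 3 / 8) (by norm_num)).comp_sub_right (4 / 3 * b)
      refine (this.const_mul (Real.exp (2 / 3 * b ^ 2))).congr (ae_of_all _ fun x => ?_)
      simp only [← Real.exp_add]
      congr 1; ring
    refine (((hg 1).add (hg (-1))).const_mul (Real.exp 1)).congr (ae_of_all _ fun x => ?_)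
    simp only [toReal_gaussianPDF, gaussianPDFReal, NNReal.coe_one, mul_one, sub_zero, smul_eq_mul,
      Pi.add_apply]
    have e : Real.exp (-3 / 8 * x ^ 2) = Real.exp (-x ^ 2 / 2) * Real.exp (x ^ 2 / 8) := by
      rw [← Real.exp_add]; congr 1; ring
    have h0 : √(2 * Real.pi) ≠ 0 := by positivity
    rw [e]
    field_simp
  refine hdom.mono' ?_ (ae_of_all _ fun x => ?_)
  · exact (continuous_normTail.measurable.comp (by fun_prop : Measurable fun x : ℝ => |x| / 2)).inv
      |>.aestronglyMeasurable
  · rw [Real.norm_of_nonneg (inv_nonneg.2 (normTail_nonneg _))]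
    have h := hlow (|x| / 2) (by positivity)
    refine (inv_anti₀ (gaussianPDFReal_pos _ _ _ one_ne_zero) h).trans ?_
    simp only [gaussianPDFReal, NNReal.coe_one, mul_one, sub_zero]
    rw [mul_inv, inv_inv, ← Real.exp_neg]
    have e : -(-(|x| / 2 + 1) ^ 2 / 2) = 1 / 2 + |x| / 2 + x ^ 2 / 8 := by
      rw [← sq_abs x]; ring
    rw [e, Real.exp_add, Real.exp_add, mul_assoc, mul_assoc, mul_assoc]
    refine mul_le_mul_of_nonneg_left ?_ (by positivity)
    refine mul_le_mul (Real.exp_le_exp.2 (by norm_num)) ?_ (by positivity) (by positivity)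
    refine mul_le_mul_of_nonneg_right ?_ (by positivity)
    refine (Real.exp_le_exp.2 (by linarith [abs_nonneg x] : |x| / 2 ≤ |x|)).trans ?_
    simpa using Real.exp_abs_le x

/-! ### The `t`-tail as a scale mixture of normal tails -/

/-- The upper tail `1 - F_{t_ν}` of the `t`-distribution. -/
def tTail (ν c : ℝ) : ℝ := 1 - cdf (studentT ν) c

lemma measurable_sqrt_div (ν : ℝ) : Measurable fun y : ℝ => √(y / ν) := by fun_prop

section

variable {ν : ℝ}

lemma isProbabilityMeasure_chiSquare (hν : 0 < ν) : IsProbabilityMeasure (chiSquare ν) :=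
  isProbabilityMeasure_gammaMeasure (by positivity) (by norm_num)

lemma isProbabilityMeasure_lawS (hν : 0 < ν) : IsProbabilityMeasure (lawS ν) :=
  have := isProbabilityMeasure_chiSquare hν
  Measure.isProbabilityMeasure_map (measurable_sqrt_div ν).aemeasurable

lemma isProbabilityMeasure_studentT (hν : 0 < ν) : IsProbabilityMeasure (studentT ν) :=
  have := isProbabilityMeasure_lawS hν
  Measure.isProbabilityMeasure_map (by fun_prop)

lemma measurable_gammaPDF (a r : ℝ) : Measurable (gammaPDF a r) :=
  (measurable_gammaPDFReal a r).ennreal_ofReal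

/-- The density is positive exactly on the positive half-line, up to the null point 0. Positivity of
`S`, absence of atoms and mass near 0 all follow. -/
lemma chiSquare_eq_zero_iff (hν : 0 < ν) (A : Set ℝ) :
    chiSquare ν A = 0 ↔ volume (Ioi 0 ∩ A) = 0 := by
  rw [chiSquare, gammaMeasure, withDensity_apply_eq_zero (measurable_gammaPDF _ _)]
  have h : ({x | gammaPDF (ν / 2) (1 / 2) x ≠ 0} ∩ A : Set ℝ) =ᵐ[volume] (Ioi 0 ∩ A : Set ℝ) := by
    refine EventuallyEq.inter ?_ EventuallyEq.rfl
    filter_upwards [Measure.ae_ne volume (0 : ℝ)] with x hx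
    refine propext ?_
    change gammaPDF (ν / 2) (1 / 2) x ≠ 0 ↔ 0 < x
    rcases lt_or_gt_of_ne hx with h | h
    · simp [gammaPDF_of_neg h, h.le]
    · have := gammaPDFReal_pos (a := ν / 2) (r := 1 / 2) (by positivity) (by norm_num) h
      simpa [gammaPDF, h] using this
  exact measure_congr h ▸ Iff.rfl

lemma lawS_ae_pos (hν : 0 < ν) : ∀ᵐ s ∂lawS ν, 0 < s := by
  rw [ae_iff, lawS, Measure.map_apply (measurable_sqrt_div ν) (by measurability),
    chiSquare_eq_zero_iff hν]
  convert measure_empty (μ := volume) using 2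
  ext y
  simp only [mem_inter_iff, mem_Ioi, mem_preimage, mem_ofPred_eq, mem_empty_iff_false, iff_false,
    not_and, not_not]
  intro hy
  positivity

lemma lawS_singleton (hν : 0 < ν) (s : ℝ) : lawS ν {s} = 0 := by
  rw [lawS, Measure.map_apply (measurable_sqrt_div ν) (measurableSet_singleton s),
    chiSquare_eq_zero_iff hν]
  refine measure_mono_null (t := {ν * s ^ 2}) ?_ (by simp)
  rintro y ⟨hy, h⟩
  simp only [mem_preimage, mem_singleton_iff, mem_Ioi] at h hy ⊢
  rw [← h, Real.sq_sqrt (by positivity)]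
  field_simp

lemma lawS_Iic_pos (hν : 0 < ν) {s : ℝ} (hs : 0 < s) : 0 < (lawS ν).real (Iic s) := by
  have := isProbabilityMeasure_lawS hν
  rw [measureReal_def, ENNReal.toReal_pos_iff]
  refine ⟨pos_iff_ne_zero.2 fun h => ?_, measure_lt_top _ _⟩
  rw [lawS, Measure.map_apply (measurable_sqrt_div ν) measurableSet_Iic,
    chiSquare_eq_zero_iff hν] at h
  have h2 : Ioc 0 (ν * s ^ 2) ⊆ Ioi 0 ∩ (fun y => √(y / ν)) ⁻¹' Iic s := by
    rintro y ⟨hy, hy2⟩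
    refine ⟨hy, ?_⟩
    simp only [mem_preimage, mem_Iic]
    rw [Real.sqrt_le_left hs.le, div_le_iff₀ hν]
    linarith
  have h3 := measure_mono_null h2 h
  rw [Real.volume_Ioc, ENNReal.ofReal_eq_zero] at h3
  have : 0 < ν * s ^ 2 := by positivity
  linarith

/-- The integral against the law of `S` in terms of the density of `S²`. -/
lemma integral_lawS (hν : 0 < ν) {h : ℝ → ℝ} (hh : Measurable h) :
    ∫ s, h s ∂lawS ν = (ν / 2) ^ (ν / 2) / Real.Gamma (ν / 2) *
      ∫ u in Ioi (0 : ℝ), h √u * (u ^ (ν / 2 - 1) * Real.exp (-(ν / 2 * u))) := by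
  rw [lawS, integral_map (measurable_sqrt_div ν).aemeasurable hh.aestronglyMeasurable, chiSquare,
    gammaMeasure, integral_withDensity_eq_integral_toReal_smul (measurable_gammaPDF _ _)
      (ae_of_all _ fun _ => by simp [gammaPDF])]
  have h1 : ∀ y, (gammaPDF (ν / 2) (1 / 2) y).toReal • h √(y / ν)
      = (Ici 0).indicator (fun y => (1 / 2) ^ (ν / 2) / Real.Gamma (ν / 2) * y ^ (ν / 2 - 1)
        * Real.exp (-(1 / 2 * y)) * h √(y / ν)) y := by
    intro y
    rw [gammaPDF, ENNReal.toReal_ofReal (gammaPDFReal_nonneg (by positivity) (by norm_num) y)]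
    by_cases hy : 0 ≤ y <;> simp [gammaPDFReal, hy]
  simp_rw [h1]
  rw [integral_indicator measurableSet_Ici, integral_Ici_eq_integral_Ioi]
  have key := integral_comp_mul_left_Ioi (fun y : ℝ => (1 / 2) ^ (ν / 2) / Real.Gamma (ν / 2)
    * y ^ (ν / 2 - 1) * Real.exp (-(1 / 2 * y)) * h √(y / ν)) 0 hν
  rw [mul_zero, smul_eq_mul, eq_inv_mul_iff_mul_eq₀ hν.ne'] at key
  rw [← key, ← integral_const_mul, ← integral_const_mul]
  refine setIntegral_congr_fun measurableSet_Ioi fun u hu => ?_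
  have hu : 0 < u := hu
  rw [mul_div_cancel_left₀ u hν.ne', Real.mul_rpow hν.le hu.le, Real.rpow_sub_one hν.ne',
    Real.div_rpow zero_le_one (by norm_num), Real.div_rpow hν.le (by norm_num), Real.one_rpow]
  have e : Real.exp (-(1 / 2 * (ν * u))) = Real.exp (-(ν / 2 * u)) := by congr 1; ring
  rw [e]
  field_simp

lemma tTail_eq_real (hν : 0 < ν) (c : ℝ) : tTail ν c = (studentT ν).real (Ioi c) := by
  have := isProbabilityMeasure_studentT hν
  rw [tTail, cdf_eq_real, ← compl_Iic, probReal_compl_eq_one_sub measurableSet_Iic]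

lemma tTail_eq_integral (hν : 0 < ν) (c : ℝ) : tTail ν c = ∫ s, normTail (c * s) ∂lawS ν := by
  have := isProbabilityMeasure_lawS hν
  have hm : Measurable fun ω : ℝ × ℝ => ω.2 / ω.1 := by fun_prop
  rw [tTail_eq_real hν, measureReal_def, studentT, Measure.map_apply hm measurableSet_Ioi,
    Measure.prod_apply (hm measurableSet_Ioi), ← integral_toReal]
  · refine integral_congr_ae ?_
    filter_upwards [lawS_ae_pos hν] with s hs
    rw [normTail, measureReal_def]
    congr 2
    ext x
    simp [lt_div_iff₀ hs]
  · exact (measurable_measure_prodMk_left (hm measurableSet_Ioi)).aemeasurable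
  · exact ae_of_all _ fun s => measure_lt_top _ _

lemma integrable_normTail_mul (hν : 0 < ν) (c : ℝ) :
    Integrable (fun s => normTail (c * s)) (lawS ν) := by
  have := isProbabilityMeasure_lawS hν
  refine Integrable.of_bound (C := 1)
    (continuous_normTail.comp (continuous_const.mul continuous_id)).aestronglyMeasurable
    (ae_of_all _ fun s => ?_)
  rw [Real.norm_of_nonneg (normTail_nonneg _)]
  exact normTail_le_one _

lemma tTail_antitone (ν : ℝ) : Antitone (tTail ν) := fun _ _ h =>
  sub_le_sub_left (monotone_cdf _ h) 1

lemma tTail_nonneg (ν c : ℝ) : 0 ≤ tTail ν c := sub_nonneg.2 (cdf_le_one _ _)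

lemma tTail_strictAnti (hν : 0 < ν) : StrictAnti (tTail ν) := by
  intro c d hcd
  have := isProbabilityMeasure_lawS hν
  rw [tTail_eq_integral hν, tTail_eq_integral hν, ← sub_pos,
    ← integral_sub (integrable_normTail_mul hν c) (integrable_normTail_mul hν d)]
  have hpos : ∀ᵐ s ∂lawS ν, 0 < normTail (c * s) - normTail (d * s) := by
    filter_upwards [lawS_ae_pos hν] with s hs
    exact sub_pos.2 (normTail_strictAnti (mul_lt_mul_of_pos_right hcd hs))
  rw [integral_pos_iff_support_of_nonneg_ae (hpos.mono fun s hs => hs.le)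
    ((integrable_normTail_mul hν c).sub (integrable_normTail_mul hν d))]
  have : lawS ν (Function.support fun s => normTail (c * s) - normTail (d * s)) = 1 :=
    (measure_congr (eventuallyEq_univ.2 (hpos.mono fun s hs => hs.ne'))).trans measure_univ
  rw [this]; exact one_pos

lemma continuous_tTail (hν : 0 < ν) : Continuous (tTail ν) := by
  have := isProbabilityMeasure_lawS hν
  rw [show tTail ν = fun c => ∫ s, normTail (c * s) ∂lawS ν from funext (tTail_eq_integral hν)]
  refine continuous_of_dominated (bound := fun _ => 1)
    (fun c => (integrable_normTail_mul hν c).aestronglyMeasurable)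
    (fun c => ae_of_all _ fun s => ?_) (integrable_const _) (ae_of_all _ fun s => ?_)
  · rw [Real.norm_of_nonneg (normTail_nonneg _)]
    exact normTail_le_one _
  · exact continuous_normTail.comp (continuous_id.mul continuous_const)

lemma tTail_zero (hν : 0 < ν) : tTail ν 0 = 1 / 2 := by
  have := isProbabilityMeasure_lawS hν
  simp [tTail_eq_integral hν, normTail_zero]

lemma tendsto_tTail_atTop (ν : ℝ) : Tendsto (tTail ν) atTop (𝓝 0) := by
  have := (tendsto_cdf_atTop (studentT ν)).const_sub 1
  rwa [sub_self] at this

lemma tTail_pos (hν : 0 < ν) (c : ℝ) : 0 < tTail ν c :=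
  (tTail_nonneg ν (c + 1)).trans_lt (tTail_strictAnti hν (lt_add_one c))

/-- Intermediate values between 0, where the tail is `1 / 2`, and infinity. The levels `u * α` with
`u ≤ 1` are reached at `c ≥ 0` because `α ≤ 1 / 2`. -/
lemma exists_tTail_eq (hν : 0 < ν) {t : ℝ} (ht : 0 < t) (ht2 : t ≤ 1 / 2) :
    ∃ c, 0 ≤ c ∧ tTail ν c = t := by
  obtain ⟨b, hb, hb0⟩ :=
    (((tendsto_tTail_atTop ν).eventually_lt_const ht).and (eventually_ge_atTop 0)).exists
  have := intermediate_value_Icc' hb0 (continuous_tTail hν).continuousOn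
  obtain ⟨c, hc, h⟩ := this ⟨hb.le, (tTail_zero hν).symm ▸ ht2⟩
  exact ⟨c, hc.1, h⟩

lemma normTail_mul_le_tTail (hν : 0 < ν) {c : ℝ} (hc : 0 ≤ c) (s : ℝ) :
    normTail (c * s) * (lawS ν).real (Iic s) ≤ tTail ν c := by
  have := isProbabilityMeasure_lawS hν
  rw [tTail_eq_integral hν]
  calc normTail (c * s) * (lawS ν).real (Iic s) = ∫ _ in Iic s, normTail (c * s) ∂lawS ν := by
        simp [mul_comm]
    _ ≤ ∫ u in Iic s, normTail (c * u) ∂lawS ν :=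
        setIntegral_mono_on (by simp) (integrable_normTail_mul hν c).integrableOn measurableSet_Iic
          fun u hu => normTail_strictAnti.antitone (mul_le_mul_of_nonneg_left hu hc)
    _ ≤ _ := setIntegral_le_integral (integrable_normTail_mul hν c)
        (ae_of_all _ fun u => normTail_nonneg _)

/-- Given `S = s`, the reciprocal of the `p`-value of a true null hypothesis is integrable. -/
lemma integrable_inv_tTail (hν : 0 < ν) {s : ℝ} (hs : 0 < s) :
    Integrable (fun x => (tTail ν (x / s))⁻¹) (gaussianReal 0 1) := by
  -- The event `S ≤ s / 2` has positive probability, so the `p`-value at `x / s` is at least a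
  -- constant times `normTail (|x| / 2)`.
  have hκ := lawS_Iic_pos hν (half_pos hs)
  refine (integrable_inv_normTail_half.mul_const ((lawS ν).real (Iic (s / 2)))⁻¹).mono'
    ((continuous_tTail hν).measurable.comp (measurable_id.div_const s)).inv.aestronglyMeasurable
    (ae_of_all _ fun x => ?_)
  rw [Real.norm_of_nonneg (inv_nonneg.2 (tTail_nonneg _ _)), ← mul_inv]
  refine inv_anti₀ (mul_pos (normTail_pos _) hκ) ?_
  have h1 := normTail_mul_le_tTail hν (div_nonneg (abs_nonneg x) hs.le) (s / 2)
  have e : |x| / s * (s / 2) = |x| / 2 := by field_simp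
  rw [e] at h1
  exact h1.trans (tTail_antitone ν (div_le_div_of_nonneg_right (le_abs_self x) hs.le))

end

/-! ### Deterministic bounds and measurability for step-up -/

section LinearStepUp

variable {α : ℝ} {n : ℕ}

lemma lsuIndex_mem (α : ℝ) (p : Fin n → ℝ) :
    lsuIndex α p ∈ (Finset.range (n + 1)).filter fun k : ℕ =>
      k ≤ (Finset.univ.filter fun i => p i ≤ k * α / n).card := by
  obtain ⟨k, hk, h⟩ := Finset.exists_mem_eq_sup _
    (⟨0, by simp⟩ : ((Finset.range (n + 1)).filter fun k : ℕ =>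
      k ≤ (Finset.univ.filter fun i => p i ≤ k * α / n).card).Nonempty) id
  rw [lsuIndex, h]
  exact hk

lemma lsuIndex_le (α : ℝ) (p : Fin n → ℝ) : lsuIndex α p ≤ n := by
  have := (Finset.mem_filter.1 (lsuIndex_mem α p)).1
  rw [Finset.mem_range] at this
  omega

lemma lsuIndex_le_card (α : ℝ) (p : Fin n → ℝ) : lsuIndex α p ≤ (lsuRejected α p).card :=
  (Finset.mem_filter.1 (lsuIndex_mem α p)).2

lemma le_lsuIndex {p : Fin n → ℝ} {k : ℕ} (hk : k ≤ n)
    (h : k ≤ (Finset.univ.filter fun i => p i ≤ k * α / n).card) : k ≤ lsuIndex α p :=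
  Finset.le_sup (f := id) (Finset.mem_filter.2 ⟨Finset.mem_range.2 (by omega), h⟩)

lemma fdp_nonneg (α : ℝ) (ϑ : Fin n → ℝ≥0∞) (p : Fin n → ℝ) : 0 ≤ fdp α ϑ p := by
  unfold fdp; positivity

lemma fdp_le_one (α : ℝ) (ϑ : Fin n → ℝ≥0∞) (p : Fin n → ℝ) : fdp α ϑ p ≤ 1 := by
  unfold fdp
  refine div_le_one_of_le₀ ?_ (by positivity)
  exact_mod_cast (Finset.card_le_card Finset.inter_subset_left).trans (le_max_left _ _)

/-- If few hypotheses are rejected, then the false discovery proportion is bounded by the average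
of the reciprocals of the small `p`-values. -/
lemma fdp_le_sum_inv (hα : 0 < α) {ϑ : Fin n → ℝ≥0∞} {p : Fin n → ℝ}
    (hp : ∀ i ∈ trueNulls ϑ, 0 < p i) {δ : ℝ} (hk : (lsuIndex α p : ℝ) ≤ δ * n) :
    fdp α ϑ p ≤ α / n * ∑ i ∈ trueNulls ϑ, if p i ≤ δ * α then (p i)⁻¹ else 0 := by
  rcases Nat.eq_zero_or_pos n with rfl | hn
  · simp [fdp, Finset.eq_empty_of_isEmpty]
  have hn' : (0 : ℝ) < n := by exact_mod_cast hn
  -- A rejected `p i` is at most `k * α / n` with `k` at most the number of rejections, so one over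
  -- that number is at most `α / (n * p i)`.
  have hR : ∀ i ∈ lsuRejected α p ∩ trueNulls ϑ,
      (((max (lsuRejected α p).card 1 : ℕ) : ℝ))⁻¹
        ≤ α / n * if p i ≤ δ * α then (p i)⁻¹ else 0 := by
    intro i hi
    obtain ⟨h1, h2⟩ := Finset.mem_inter.1 hi
    have hpi := hp i h2
    have h3 : p i ≤ lsuIndex α p * α / n := (Finset.mem_filter.1 h1).2
    have h4 : p i ≤ δ * α := by
      refine h3.trans ?_
      rw [div_le_iff₀ hn']
      nlinarith
    rw [if_pos h4, div_mul_eq_mul_div, ← div_eq_mul_inv, div_div,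
      inv_le_comm₀ (by positivity) (by positivity), inv_div]
    have h5 : ((lsuIndex α p : ℕ) : ℝ) ≤ (max (lsuRejected α p).card 1 : ℕ) := by
      exact_mod_cast (lsuIndex_le_card α p).trans (le_max_left _ _)
    refine le_trans ?_ h5
    rw [div_le_iff₀ hα]
    rwa [le_div_iff₀ hn'] at h3
  calc fdp α ϑ p = ∑ i ∈ lsuRejected α p ∩ trueNulls ϑ,
        (((max (lsuRejected α p).card 1 : ℕ) : ℝ))⁻¹ := by
        rw [fdp, Finset.sum_const, nsmul_eq_mul, div_eq_mul_inv]
    _ ≤ ∑ i ∈ lsuRejected α p ∩ trueNulls ϑ, α / n * if p i ≤ δ * α then (p i)⁻¹ else 0 :=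
        Finset.sum_le_sum hR
    _ ≤ ∑ i ∈ trueNulls ϑ, α / n * if p i ≤ δ * α then (p i)⁻¹ else 0 := by
        refine Finset.sum_le_sum_of_subset_of_nonneg Finset.inter_subset_right fun i hi _ => ?_
        have := hp i hi
        split_ifs <;> positivity
    _ = _ := by rw [Finset.mul_sum]

/-- Correct rejections number at most the non-true hypotheses, while there are at least `m`
rejections in all. -/
lemma one_sub_le_fdp {ϑ : Fin n → ℝ≥0∞} {p : Fin n → ℝ} {m : ℕ} (hm : 0 < m)
    (hk : m ≤ lsuIndex α p) :
    1 - ((trueNulls ϑ)ᶜ.card : ℝ) / m ≤ fdp α ϑ p := by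
  have hR : m ≤ (lsuRejected α p).card := hk.trans (lsuIndex_le_card α p)
  have hR' : (m : ℝ) ≤ (lsuRejected α p).card := by exact_mod_cast hR
  have hm' : (0 : ℝ) < m := by exact_mod_cast hm
  have hmax : max (lsuRejected α p).card 1 = (lsuRejected α p).card := max_eq_left (by omega)
  have hcard : (lsuRejected α p).card
      ≤ (lsuRejected α p ∩ trueNulls ϑ).card + (trueNulls ϑ)ᶜ.card := by
    rw [← Finset.card_inter_add_card_sdiff (lsuRejected α p) (trueNulls ϑ)]
    refine Nat.add_le_add_left (Finset.card_le_card fun i hi => ?_) _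
    exact Finset.mem_compl.2 (Finset.mem_sdiff.1 hi).2
  have hcard' : ((lsuRejected α p).card : ℝ)
      ≤ (lsuRejected α p ∩ trueNulls ϑ).card + (trueNulls ϑ)ᶜ.card := by exact_mod_cast hcard
  have hRpos : (0 : ℝ) < (lsuRejected α p).card := hm'.trans_le hR'
  rw [fdp, hmax]
  have h1 : ((trueNulls ϑ)ᶜ.card : ℝ) / (lsuRejected α p).card ≤ ((trueNulls ϑ)ᶜ.card : ℝ) / m := by
    gcongr
  have h2 : 1 - ((trueNulls ϑ)ᶜ.card : ℝ) / (lsuRejected α p).card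
      ≤ ((lsuRejected α p ∩ trueNulls ϑ).card : ℝ) / (lsuRejected α p).card := by
    rw [one_sub_div hRpos.ne']
    exact div_le_div_of_nonneg_right (by linarith) hRpos.le
  linarith

lemma measurable_card_filter {Ω ι : Type*} [MeasurableSpace Ω] (s : Finset ι) (P : Ω → ι → Prop)
    [∀ ω, DecidablePred (P ω)] (hP : ∀ i, MeasurableSet {ω | P ω i}) :
    Measurable fun ω => (s.filter (P ω)).card := by
  simp_rw [Finset.card_filter]
  exact Finset.measurable_sum _ fun i _ => Measurable.ite (hP i) measurable_const measurable_const

lemma measurable_finset_sup_nat {Ω ι : Type*} [MeasurableSpace Ω] (s : Finset ι) (f : ι → Ω → ℕ)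
    (hf : ∀ i, Measurable (f i)) : Measurable fun ω => s.sup fun i => f i ω := by
  classical
  induction s using Finset.induction_on with
  | empty => simp
  | insert a s _ ih =>
    simp only [Finset.sup_insert]
    exact (hf a).sup ih

lemma measurable_lsuIndex (α : ℝ) : Measurable fun p : Fin n → ℝ => lsuIndex α p := by
  have h : (fun p : Fin n → ℝ => lsuIndex α p) = fun p => (Finset.range (n + 1)).sup fun k : ℕ =>
      if k ≤ (Finset.univ.filter fun i => p i ≤ k * α / n).card then k else 0 := by
    ext p
    refine le_antisymm (Finset.sup_le fun k hk => ?_) (Finset.sup_le fun k hk => ?_)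
    · obtain ⟨h1, h2⟩ := Finset.mem_filter.1 hk
      refine le_trans ?_ (Finset.le_sup h1)
      rw [if_pos h2]; rfl
    · split_ifs with h2
      · exact Finset.le_sup (f := id) (Finset.mem_filter.2 ⟨hk, h2⟩)
      · exact Nat.zero_le _
  rw [h]
  refine measurable_finset_sup_nat _ _ fun k => ?_
  refine Measurable.ite ?_ measurable_const measurable_const
  exact measurableSet_le measurable_const (measurable_card_filter _ _ fun i =>
    measurableSet_le (measurable_pi_apply i) measurable_const)

lemma measurable_fdp (α : ℝ) (ϑ : Fin n → ℝ≥0∞) : Measurable fun p : Fin n → ℝ => fdp α ϑ p := by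
  have hr : ∀ i, MeasurableSet {p : Fin n → ℝ | p i ≤ lsuIndex α p * α / n} := fun i =>
    measurableSet_le (measurable_pi_apply i) ((((measurable_from_nat (f := fun k : ℕ => (k : ℝ))).comp
      (measurable_lsuIndex α)).mul_const α).div_const _)
  have h1 : Measurable fun p : Fin n → ℝ => (lsuRejected α p).card :=
    measurable_card_filter _ _ hr
  have h2 : Measurable fun p : Fin n → ℝ => (lsuRejected α p ∩ trueNulls ϑ).card := by
    simp_rw [lsuRejected, Finset.filter_inter, Finset.univ_inter]
    exact measurable_card_filter _ _ hr
  exact ((measurable_from_nat (f := fun k : ℕ => (k : ℝ))).comp h2).div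
    ((measurable_from_nat (f := fun k : ℕ => ((max k 1 : ℕ) : ℝ))).comp h1)

end LinearStepUp

/-! ### Weak law of large numbers for counts -/

section WeakLaw

/-- The number of coordinates of `x` lying in `A`. -/
def hits (A : Set ℝ) {n : ℕ} (x : Fin n → ℝ) : ℝ := ∑ i, A.indicator 1 (x i)

lemma card_filter_le_hits {A : Set ℝ} {n : ℕ} {x : Fin n → ℝ} {P : Fin n → Prop}
    [DecidablePred P] (s : Finset (Fin n)) (h : ∀ i ∈ s, P i → x i ∈ A) :
    ((s.filter P).card : ℝ) ≤ hits A x := by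
  rw [Finset.card_filter, Nat.cast_sum, hits]
  refine (Finset.sum_le_sum (g := fun i => A.indicator 1 (x i)) fun i hi => ?_).trans
    (Finset.sum_le_sum_of_subset_of_nonneg (Finset.subset_univ s) fun i _ _ =>
      indicator_nonneg (fun _ _ => zero_le_one) _)
  split_ifs with hP
  · simp [indicator_of_mem (h i hi hP)]
  · rw [Nat.cast_zero]
    exact indicator_nonneg (fun _ _ => zero_le_one) (x i)

lemma hits_le_card_filter {A : Set ℝ} {n : ℕ} {x : Fin n → ℝ} {P : Fin n → Prop}
    [DecidablePred P] (h : ∀ i, x i ∈ A → P i) :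
    hits A x ≤ ((Finset.univ.filter P).card : ℝ) := by
  rw [Finset.card_filter, Nat.cast_sum, hits]
  refine Finset.sum_le_sum fun i _ => ?_
  by_cases hx : x i ∈ A
  · simp [hx, h i hx]
  · rw [indicator_of_notMem hx]; positivity

variable (γ : Measure ℝ) [IsProbabilityMeasure γ]

/-- Chebyshev's inequality; an indicator has variance at most `1 / 4`. -/
lemma measureReal_hits_deviation_le {A : Set ℝ} (hA : MeasurableSet A) {n : ℕ} (hn : 0 < n)
    {ε : ℝ} (hε : 0 < ε) :
    (Measure.pi fun _ : Fin n => γ).real {x | ε * n ≤ |hits A x - n * γ.real A|}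
      ≤ 1 / (4 * ε ^ 2) * (n : ℝ)⁻¹ := by
  have hn' : (0 : ℝ) < n := by exact_mod_cast hn
  have hm : Measurable (A.indicator (1 : ℝ → ℝ)) := measurable_one.indicator hA
  have hb : ∀ᵐ y ∂γ, A.indicator (1 : ℝ → ℝ) y ∈ Icc (0 : ℝ) 1 := ae_of_all _ fun y =>
    ⟨indicator_nonneg (fun _ _ => zero_le_one) _, indicator_le_self' (fun _ _ => zero_le_one) _⟩
  have hL : MemLp (A.indicator (1 : ℝ → ℝ)) 2 γ := memLp_of_bounded hb hm.aestronglyMeasurable 2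
  have hLi : ∀ i : Fin n, MemLp (fun x : Fin n → ℝ => A.indicator (1 : ℝ → ℝ) (x i)) 2
      (Measure.pi fun _ : Fin n => γ) := fun i =>
    hL.comp_measurePreserving (measurePreserving_eval (fun _ : Fin n => γ) i)
  have hsum : hits A = ∑ i, fun x : Fin n → ℝ => A.indicator (1 : ℝ → ℝ) (x i) := by
    ext x; simp [hits]
  have hLs : MemLp (hits A (n := n)) 2 (Measure.pi fun _ : Fin n => γ) := by
    rw [hsum]; exact memLp_finsetSum' _ fun i _ => hLi i
  have hE : ∫ x, hits A x ∂(Measure.pi fun _ : Fin n => γ) = n * γ.real A := by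
    unfold hits
    rw [integral_finsetSum _ fun i _ => (hLi i).integrable one_le_two]
    have : ∀ i : Fin n, ∫ x, A.indicator (1 : ℝ → ℝ) (x i) ∂(Measure.pi fun _ : Fin n => γ)
        = γ.real A := fun i => by
      rw [integral_comp_eval (μ := fun _ : Fin n => γ) hm.aestronglyMeasurable,
        integral_indicator_one hA]
    simp [this]
  have hV : Var[hits A; Measure.pi fun _ : Fin n => γ] ≤ n * (1 / 4) := by
    rw [hsum, variance_sum_pi (X := fun _ => A.indicator (1 : ℝ → ℝ)) fun _ => hL]
    have := variance_le_sq_of_bounded hb hm.aemeasurable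
    simp only [Finset.sum_const, Finset.card_univ, Fintype.card_fin, nsmul_eq_mul]
    gcongr
    linarith
  have h := meas_ge_le_variance_div_sq hLs (mul_pos hε hn')
  rw [hE] at h
  have h2 : (Measure.pi fun _ : Fin n => γ).real {x | ε * n ≤ |hits A x - n * γ.real A|}
      ≤ Var[hits A; Measure.pi fun _ : Fin n => γ] / (ε * n) ^ 2 :=
    ENNReal.toReal_le_of_le_ofReal (div_nonneg (variance_nonneg _ _) (by positivity)) h
  refine h2.trans ?_
  rw [div_le_iff₀ (by positivity)]
  refine hV.trans (le_of_eq ?_)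
  field_simp

lemma tendsto_measureReal_hits_deviation {A : Set ℝ} (hA : MeasurableSet A) {ε : ℝ} (hε : 0 < ε) :
    Tendsto (fun n : ℕ => (Measure.pi fun _ : Fin n => γ).real
      {x | ε * n ≤ |hits A x - n * γ.real A|}) atTop (𝓝 0) := by
  have h := (tendsto_inv_atTop_nhds_zero_nat (𝕜 := ℝ)).const_mul (1 / (4 * ε ^ 2))
  rw [mul_zero] at h
  refine squeeze_zero' (Eventually.of_forall fun _ => measureReal_nonneg) ?_ h
  filter_upwards [eventually_gt_atTop 0] with n hn
  exact measureReal_hits_deviation_le γ hA hn hε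

lemma tendsto_measureReal_hits_lt {A : Set ℝ} (hA : MeasurableSet A) {q : ℝ} (hq : q < γ.real A) :
    Tendsto (fun n : ℕ => (Measure.pi fun _ : Fin n => γ).real {x | hits A x < q * n})
      atTop (𝓝 0) := by
  refine squeeze_zero (fun _ => measureReal_nonneg) (fun n => measureReal_mono fun x hx => ?_)
    (tendsto_measureReal_hits_deviation γ hA (sub_pos.2 hq))
  have hx : hits A x < q * n := hx
  change (γ.real A - q) * n ≤ |hits A x - n * γ.real A|
  rw [abs_sub_comm]
  refine le_trans ?_ (le_abs_self _)
  linarith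

/-- The term `e n` makes room for the `o(n)` hypotheses that are not true; half of the gap absorbs
it. -/
lemma tendsto_measureReal_le_hits_add {A : Set ℝ} (hA : MeasurableSet A) {q : ℝ}
    (hq : γ.real A < q) {e : ℕ → ℝ} (he : Tendsto (fun n => e n / n) atTop (𝓝 0)) :
    Tendsto (fun n : ℕ => (Measure.pi fun _ : Fin n => γ).real {x | q * n ≤ hits A x + e n})
      atTop (𝓝 0) := by
  have hε : 0 < (q - γ.real A) / 2 := half_pos (sub_pos.2 hq)
  refine squeeze_zero' (Eventually.of_forall fun _ => measureReal_nonneg) ?_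
    (tendsto_measureReal_hits_deviation γ hA hε)
  filter_upwards [he.eventually_lt_const hε, eventually_gt_atTop 0] with n hn hn0
  have hn' : (0 : ℝ) < n := by exact_mod_cast hn0
  rw [div_lt_iff₀ hn'] at hn
  refine measureReal_mono fun x hx => ?_
  have hx : q * n ≤ hits A x + e n := hx
  change (q - γ.real A) / 2 * n ≤ |hits A x - n * γ.real A|
  refine le_trans ?_ (le_abs_self _)
  linarith

end WeakLaw

/-! ### The false discovery rate given `S = s` -/

/-- The bound by `g` may fail on the bad event `E`, where `f ≤ 1` is used. A measurable hull of `E`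
spares any measurability check. -/
lemma integral_le_add_measureReal {Ω : Type*} [MeasurableSpace Ω] {μ : Measure Ω}
    [IsProbabilityMeasure μ] {f g : Ω → ℝ} {E : Set Ω} (hf : Measurable f) (hg : Integrable g μ)
    (hg0 : ∀ ω, 0 ≤ g ω) (h0 : ∀ ω, 0 ≤ f ω) (h1 : ∀ ω, f ω ≤ 1) (h : ∀ ω, ω ∉ E → f ω ≤ g ω) :
    ∫ ω, f ω ∂μ ≤ ∫ ω, g ω ∂μ + μ.real E := by
  have hE : MeasurableSet (toMeasurable μ E) := measurableSet_toMeasurable μ E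
  have e : μ.real E = ∫ ω, (toMeasurable μ E).indicator 1 ω ∂μ := by
    rw [integral_indicator_one hE, measureReal_def, measureReal_def, measure_toMeasurable]
  have hi : Integrable ((toMeasurable μ E).indicator (1 : Ω → ℝ)) μ :=
    (integrable_const (1 : ℝ)).indicator hE
  rw [e, ← integral_add hg hi]
  refine integral_mono (Integrable.of_bound (C := 1) hf.aestronglyMeasurable
    (ae_of_all _ fun ω => by rw [Real.norm_of_nonneg (h0 ω)]; exact h1 ω)) (hg.add hi) fun ω => ?_
  by_cases hω : ω ∈ E
  · have : ω ∈ toMeasurable μ E := subset_toMeasurable μ E hω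
    simp only [indicator_of_mem this, Pi.one_apply]
    linarith [h1 ω, hg0 ω]
  · have := indicator_nonneg (s := toMeasurable μ E) (f := (1 : Ω → ℝ))
      (fun _ _ => zero_le_one) ω
    linarith [h ω hω]

/-- The false discovery rate given `S = s`. -/
def condFDR (ν α : ℝ) {n : ℕ} (ϑ : Fin n → ℝ≥0∞) (s : ℝ) : ℝ :=
  ∫ x, fdp α ϑ (pValue ν ϑ (s, x)) ∂(Measure.pi fun _ : Fin n => gaussianReal 0 1)

lemma pValue_eq (ν : ℝ) {n : ℕ} (ϑ : Fin n → ℝ≥0∞) (s : ℝ) (x : Fin n → ℝ) (i : Fin n) :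
    pValue ν ϑ (s, x) i = if ϑ i = ∞ then 0 else tTail ν (x i / s) := rfl

lemma pValue_le_tTail (ν : ℝ) {n : ℕ} (ϑ : Fin n → ℝ≥0∞) (s : ℝ) (x : Fin n → ℝ) (i : Fin n) :
    pValue ν ϑ (s, x) i ≤ tTail ν (x i / s) := by
  rw [pValue_eq]
  split_ifs
  · exact tTail_nonneg _ _
  · exact le_rfl

lemma pValue_of_mem_trueNulls (ν : ℝ) {n : ℕ} {ϑ : Fin n → ℝ≥0∞} (s : ℝ) (x : Fin n → ℝ)
    {i : Fin n} (hi : i ∈ trueNulls ϑ) : pValue ν ϑ (s, x) i = tTail ν (x i / s) := by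
  rw [pValue_eq, (Finset.mem_filter.1 hi).2]; simp

lemma measurable_pValue (ν : ℝ) {n : ℕ} (ϑ : Fin n → ℝ≥0∞) : Measurable (pValue ν ϑ) := by
  refine measurable_pi_iff.2 fun i => ?_
  change Measurable fun ω : ℝ × (Fin n → ℝ) => if ϑ i = ∞ then 0 else tTail ν (ω.2 i / ω.1)
  split_ifs
  · exact measurable_const
  · exact (tTail_antitone ν).measurable.comp (by fun_prop)

lemma measurable_fdp_pValue (ν α : ℝ) {n : ℕ} (ϑ : Fin n → ℝ≥0∞) :
    Measurable fun ω => fdp α ϑ (pValue ν ϑ ω) :=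
  (measurable_fdp α ϑ).comp (measurable_pValue ν ϑ)

lemma measurable_fdp_pValue_mk (ν α : ℝ) {n : ℕ} (ϑ : Fin n → ℝ≥0∞) (s : ℝ) :
    Measurable fun x => fdp α ϑ (pValue ν ϑ (s, x)) :=
  (measurable_fdp_pValue ν α ϑ).comp measurable_prodMk_left

lemma condFDR_nonneg (ν α : ℝ) {n : ℕ} (ϑ : Fin n → ℝ≥0∞) (s : ℝ) : 0 ≤ condFDR ν α ϑ s :=
  integral_nonneg fun _ => fdp_nonneg _ _ _

lemma integrable_fdp_pValue_mk (ν α : ℝ) {n : ℕ} (ϑ : Fin n → ℝ≥0∞) (s : ℝ) :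
    Integrable (fun x => fdp α ϑ (pValue ν ϑ (s, x)))
      (Measure.pi fun _ : Fin n => gaussianReal 0 1) := by
  refine Integrable.of_bound (C := 1) (measurable_fdp_pValue_mk ν α ϑ s).aestronglyMeasurable
    (ae_of_all _ fun ω => ?_)
  rw [Real.norm_of_nonneg (fdp_nonneg _ _ _)]
  exact fdp_le_one _ _ _

lemma condFDR_le_one (ν α : ℝ) {n : ℕ} (ϑ : Fin n → ℝ≥0∞) (s : ℝ) : condFDR ν α ϑ s ≤ 1 := by
  have := integral_mono (integrable_fdp_pValue_mk ν α ϑ s) (integrable_const 1)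
    fun x => fdp_le_one _ _ _
  simpa [condFDR] using this

lemma FDR_eq_integral_condFDR {ν : ℝ} (hν : 0 < ν) (α : ℝ) {n : ℕ} {ϑ : Fin n → ℝ≥0∞}
    (hϑ : IsExtreme ϑ) : FDR ν α ϑ = ∫ s, condFDR ν α ϑ s ∂lawS ν := by
  have := isProbabilityMeasure_lawS hν
  -- Since `∞.toReal = 0`, all coordinates of an extreme configuration are standard normal,
  -- including those that the `p`-values ignore.
  have h0 : ∀ i, (ϑ i).toReal = 0 := fun i => by rcases hϑ i with h | h <;> simp [h]
  simp only [FDR, model, h0, condFDR]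
  refine integral_prod _ (Integrable.of_bound (C := 1)
    (measurable_fdp_pValue ν α ϑ).aestronglyMeasurable (ae_of_all _ fun ω => ?_))
  rw [Real.norm_of_nonneg (fdp_nonneg _ _ _)]
  exact fdp_le_one _ _ _

lemma tendsto_card_compl_trueNulls {ϑ : (n : ℕ) → Fin n → ℝ≥0∞}
    (hζ : Tendsto (fun n => trueProportion (ϑ n)) atTop (𝓝 1)) :
    Tendsto (fun n : ℕ => ((trueNulls (ϑ n))ᶜ.card : ℝ) / n) atTop (𝓝 0) := by
  have h := hζ.const_sub 1
  rw [sub_self] at h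
  refine h.congr' ?_
  filter_upwards [eventually_gt_atTop 0] with n hn
  have hn' : (n : ℝ) ≠ 0 := by exact_mod_cast hn.ne'
  have := Finset.card_add_card_compl (trueNulls (ϑ n))
  rw [Fintype.card_fin] at this
  have : ((trueNulls (ϑ n)).card : ℝ) + (trueNulls (ϑ n))ᶜ.card = n := by exact_mod_cast this
  rw [trueProportion]
  field_simp
  linarith

section Conditional

variable {ν α s : ℝ} {ϑ : (n : ℕ) → Fin n → ℝ≥0∞}

/-- Above the boundary curve almost all rejections are false. -/
lemma tendsto_condFDR_one (hν : 0 < ν) (hα : 0 < α) (hs : 0 < s)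
    (hζ : Tendsto (fun n => trueProportion (ϑ n)) atTop (𝓝 1)) {c : ℝ}
    (hc : tTail ν c < α * normTail (c * s)) :
    Tendsto (fun n => condFDR ν α (ϑ n) s) atTop (𝓝 1) := by
  set t := tTail ν c with ht_def
  have ht : 0 < t := tTail_pos hν c
  have hq : t / α < (gaussianReal 0 1).real (Ici (c * s)) := by
    rw [measureReal_Ici, div_lt_iff₀ hα]; linarith
  obtain ⟨q, hq1, hq2⟩ := exists_between hq
  have hqpos : 0 < t / α := div_pos ht hα
  have hbad := tendsto_measureReal_hits_lt (gaussianReal 0 1) measurableSet_Ici hq2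
  have hn1 := (tendsto_card_compl_trueNulls hζ).div_const (t / α)
  have hlow := (hn1.add hbad).const_sub 1
  rw [zero_div, add_zero, sub_zero] at hlow
  refine tendsto_of_tendsto_of_tendsto_of_le_of_le' hlow tendsto_const_nhds ?_
    (Eventually.of_forall fun n => condFDR_le_one _ _ _ _)
  -- From here on `(q - t / α) * n ≥ 1`, which pays for rounding up in `m`.
  have hlarge : ∀ᶠ n : ℕ in atTop, 1 / (q - t / α) ≤ n :=
    tendsto_natCast_atTop_atTop.eventually_ge_atTop _
  filter_upwards [hlarge, eventually_gt_atTop 0] with n hn hn0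
  have hn' : (0 : ℝ) < n := by exact_mod_cast hn0
  rw [div_le_iff₀ (sub_pos.2 hq1)] at hn
  -- The least index whose critical value `m * α / n` reaches `t`. Every coordinate above `c * s`
  -- has `p`-value at most `t`, and there are at least `q * n ≥ m` of them off the bad event.
  set m := ⌈t / α * n⌉₊ with hm_def
  have hm1 : t / α * n ≤ m := Nat.le_ceil _
  have hm2 : (m : ℝ) < t / α * n + 1 := Nat.ceil_lt_add_one (by positivity)
  have hm0 : 0 < m := Nat.ceil_pos.2 (by positivity)
  have hgood : ∀ x : Fin n → ℝ, x ∉ {x | hits (Ici (c * s)) x < q * n} →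
      1 - fdp α (ϑ n) (pValue ν (ϑ n) (s, x)) ≤ ((trueNulls (ϑ n))ᶜ.card : ℝ) / n / (t / α) := by
    intro x hx
    have hx : q * n ≤ hits (Ici (c * s)) x := not_lt.1 hx
    have hcount : hits (Ici (c * s)) x
        ≤ (Finset.univ.filter fun i => pValue ν (ϑ n) (s, x) i ≤ m * α / n).card := by
      refine hits_le_card_filter fun i hi => ?_
      refine (pValue_le_tTail _ _ _ _ _).trans ((tTail_antitone ν
        ((le_div_iff₀ hs).2 hi)).trans ?_)
      rw [le_div_iff₀ hn', ← div_le_iff₀ hα]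
      refine le_trans (le_of_eq ?_) hm1
      rw [← ht_def]; ring
    have hmc : m ≤ (Finset.univ.filter fun i => pValue ν (ϑ n) (s, x) i ≤ m * α / n).card := by
      have : (m : ℝ) ≤ (Finset.univ.filter fun i =>
        pValue ν (ϑ n) (s, x) i ≤ m * α / n).card := by linarith
      exact_mod_cast this
    have hmn : m ≤ n := hmc.trans ((Finset.card_le_univ _).trans_eq (Fintype.card_fin n))
    have h1 := one_sub_le_fdp (ϑ := ϑ n) hm0 (le_lsuIndex hmn hmc)
    have h2 : ((trueNulls (ϑ n))ᶜ.card : ℝ) / m ≤ ((trueNulls (ϑ n))ᶜ.card : ℝ) / n / (t / α) := by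
      rw [div_div]
      refine div_le_div_of_nonneg_left (by positivity) (by positivity) ?_
      linarith
    linarith
  have key := integral_le_add_measureReal (μ := Measure.pi fun _ : Fin n => gaussianReal 0 1)
    ((measurable_fdp_pValue_mk ν α (ϑ n) s).const_sub 1)
    (integrable_const (((trueNulls (ϑ n))ᶜ.card : ℝ) / n / (t / α))) (fun _ => by positivity)
    (fun x => sub_nonneg.2 (fdp_le_one _ _ _)) (fun x => sub_le_self _ (fdp_nonneg _ _ _)) hgood
  rw [integral_sub (integrable_const _) (integrable_fdp_pValue_mk ν α (ϑ n) s)] at key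
  simp only [integral_const, probReal_univ, smul_eq_mul, one_mul] at key
  change 1 - condFDR ν α (ϑ n) s ≤ _ at key
  linarith

/-- Below the boundary curve, the proportion of rejected hypotheses tends to `0`. -/
lemma tendsto_measureReal_lt_lsuIndex (hν : 0 < ν) (hα0 : 0 < α) (hα : α ≤ 1 / 2) (hs : 0 < s)
    (hζ : Tendsto (fun n => trueProportion (ϑ n)) atTop (𝓝 1))
    (hc : ∀ c, 0 ≤ c → α * normTail (c * s) < tTail ν c) {δ : ℝ} (hδ : 0 < δ) :
    Tendsto (fun n : ℕ => (Measure.pi fun _ : Fin n => gaussianReal 0 1).real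
      {x | δ * n < lsuIndex α (pValue ν (ϑ n) (s, x))}) atTop (𝓝 0) := by
  -- The event that some admissible index `k` has `k / n` in `K`. It is negligible for `K` near each
  -- point of `[δ, 1]`, and compactness makes this uniform in `k`.
  let E : Set ℝ → (n : ℕ) → Set (Fin n → ℝ) := fun K n => {x | ∃ k : ℕ, (k : ℝ) / n ∈ K ∧
    k ≤ (Finset.univ.filter fun i => pValue ν (ϑ n) (s, x) i ≤ k * α / n).card}
  have hE : Tendsto (fun n : ℕ => (Measure.pi fun _ : Fin n => gaussianReal 0 1).real
      (E (Icc δ 1) n)) atTop (𝓝 0) := by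
    refine isCompact_Icc.induction_on (p := fun K => Tendsto (fun n : ℕ =>
      (Measure.pi fun _ : Fin n => gaussianReal 0 1).real (E K n)) atTop (𝓝 0)) ?_ ?_ ?_ ?_
    · simp [E]
    · intro K L hKL hL
      refine squeeze_zero (fun _ => measureReal_nonneg) (fun n => measureReal_mono ?_) hL
      rintro x ⟨k, hk, h⟩
      exact ⟨k, hKL hk, h⟩
    · intro K L hK hL
      have := hK.add hL
      rw [add_zero] at this
      refine squeeze_zero (fun _ => measureReal_nonneg) (fun n => ?_) this
      refine (measureReal_mono ?_).trans (measureReal_union_le _ _)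
      rintro x ⟨k, hk | hk, h⟩
      · exact Or.inl ⟨k, hk, h⟩
      · exact Or.inr ⟨k, hk, h⟩
    · intro u hu
      have hupos : 0 < u := hδ.trans_le hu.1
      obtain ⟨c, hc0, hct⟩ := exists_tTail_eq hν (mul_pos hupos hα0)
        ((mul_le_of_le_one_left hα0.le hu.2).trans hα)
      have h1 : normTail (c * s) < u := by
        have := hc c hc0
        rw [hct, mul_comm u α] at this
        exact lt_of_mul_lt_mul_left this hα0.le
      -- The strict inequality at `c` survives a small move to the left, which raises the critical
      -- value above `u * α`. So one threshold `c'` serves all `k / n` in a neighbourhood of `u`.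
      have h2 : ∀ᶠ c' in 𝓝[<] c, normTail (c' * s) < u := by
        refine nhdsWithin_le_nhds (Tendsto.eventually_lt_const h1 ?_)
        exact (continuous_normTail.comp (continuous_id.mul continuous_const)).tendsto c
      obtain ⟨c', hc'u, hc'⟩ := (h2.and self_mem_nhdsWithin).exists
      obtain ⟨q, hq1, hq2⟩ := exists_between hc'u
      have h3 : u < tTail ν c' / α := by
        rw [lt_div_iff₀ hα0, ← hct]
        exact tTail_strictAnti hν hc'
      refine ⟨Ioo q (tTail ν c' / α), mem_nhdsWithin_of_mem_nhds (Ioo_mem_nhds hq2 h3), ?_⟩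
      refine squeeze_zero' (Eventually.of_forall fun _ => measureReal_nonneg) ?_
        (tendsto_measureReal_le_hits_add (gaussianReal 0 1) (measurableSet_Ioi (a := c' * s)) hq1
          (tendsto_card_compl_trueNulls hζ))
      filter_upwards [eventually_gt_atTop 0] with n hn0
      have hn' : (0 : ℝ) < n := by exact_mod_cast hn0
      refine measureReal_mono ?_
      rintro x ⟨k, ⟨hk1, hk2⟩, h⟩
      rw [lt_div_iff₀ hn'] at hk1
      refine hk1.le.trans ((Nat.cast_le.2 h).trans ?_)
      have hsplit : (Finset.univ.filter fun i => pValue ν (ϑ n) (s, x) i ≤ k * α / n).card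
          ≤ ((trueNulls (ϑ n)).filter fun i => pValue ν (ϑ n) (s, x) i ≤ k * α / n).card
            + (trueNulls (ϑ n))ᶜ.card := by
        refine (Finset.card_le_card fun i hi => ?_).trans (Finset.card_union_le _ _)
        simp only [Finset.mem_union, Finset.mem_filter, Finset.mem_compl, Finset.mem_univ,
          true_and] at hi ⊢
        tauto
      refine (Nat.cast_le.2 hsplit).trans ?_
      rw [Nat.cast_add]
      refine add_le_add_left (card_filter_le_hits _ fun i hi hp => ?_) _
      rw [pValue_of_mem_trueNulls ν s x hi] at hp
      rw [lt_div_iff₀ hα0, div_mul_eq_mul_div] at hk2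
      exact (lt_div_iff₀ hs).1 ((tTail_strictAnti hν).lt_iff_gt.1 (hp.trans_lt hk2))
  refine squeeze_zero' (Eventually.of_forall fun _ => measureReal_nonneg) ?_ hE
  filter_upwards [eventually_gt_atTop 0] with n hn0
  have hn' : (0 : ℝ) < n := by exact_mod_cast hn0
  refine measureReal_mono fun x hx => ?_
  have hx : δ * n < lsuIndex α (pValue ν (ϑ n) (s, x)) := hx
  refine ⟨lsuIndex α (pValue ν (ϑ n) (s, x)), ⟨((lt_div_iff₀ hn').2 hx).le, ?_⟩,
    lsuIndex_le_card α _⟩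
  rw [div_le_one hn']
  exact_mod_cast lsuIndex_le α _

/-- Below the boundary curve almost all rejections are correct. -/
lemma tendsto_condFDR_zero (hν : 0 < ν) (hα0 : 0 < α) (hα : α ≤ 1 / 2) (hs : 0 < s)
    (hζ : Tendsto (fun n => trueProportion (ϑ n)) atTop (𝓝 1))
    (hc : ∀ c, 0 ≤ c → α * normTail (c * s) < tTail ν c) :
    Tendsto (fun n => condFDR ν α (ϑ n) s) atTop (𝓝 0) := by
  -- The reciprocal `p`-value truncated to `p`-values at most `δ * α`. As `δ` decreases to 0 it
  -- vanishes pointwise, since `p`-values are positive, and its mean tends to 0 by domination.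
  let F : ℝ → ℝ → ℝ := fun δ y => if tTail ν (y / s) ≤ δ * α then (tTail ν (y / s))⁻¹ else 0
  have hF0 : ∀ δ y, 0 ≤ F δ y := fun δ y => by
    simp only [F]; split_ifs
    · exact inv_nonneg.2 (tTail_nonneg _ _)
    · exact le_rfl
  have hFle : ∀ δ y, F δ y ≤ (tTail ν (y / s))⁻¹ := fun δ y => by
    simp only [F]; split_ifs
    · exact le_rfl
    · exact inv_nonneg.2 (tTail_nonneg _ _)
  have hmT : Measurable fun y => tTail ν (y / s) :=
    (continuous_tTail hν).measurable.comp (measurable_id.div_const s)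
  have hFm : ∀ δ, Measurable (F δ) := fun δ =>
    Measurable.ite (measurableSet_le hmT measurable_const) hmT.inv measurable_const
  have hFi : ∀ δ, Integrable (F δ) (gaussianReal 0 1) := fun δ =>
    (integrable_inv_tTail hν hs).mono' (hFm δ).aestronglyMeasurable (ae_of_all _ fun y => by
      rw [Real.norm_of_nonneg (hF0 δ y)]; exact hFle δ y)
  have hlim : Tendsto (fun δ => α * ∫ y, F δ y ∂gaussianReal 0 1) (𝓝[>] 0) (𝓝 0) := by
    have : Tendsto (fun δ => ∫ y, F δ y ∂gaussianReal 0 1) (𝓝[>] 0)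
        (𝓝 (∫ _, (0 : ℝ) ∂gaussianReal 0 1)) := by
      refine tendsto_integral_filter_of_dominated_convergence _
        (Eventually.of_forall fun δ => (hFm δ).aestronglyMeasurable)
        (Eventually.of_forall fun δ => ae_of_all _ fun y => by
          rw [Real.norm_of_nonneg (hF0 δ y)]; exact hFle δ y)
        (integrable_inv_tTail hν hs) (ae_of_all _ fun y => ?_)
      refine tendsto_const_nhds.congr' ?_
      have h0 : ∀ᶠ δ in 𝓝[>] (0 : ℝ), δ * α < tTail ν (y / s) := by
        refine nhdsWithin_le_nhds (Tendsto.eventually_lt_const (v := 0 * α) ?_ ?_)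
        · rw [zero_mul]; exact tTail_pos hν _
        · exact (continuous_id.mul continuous_const).tendsto 0
      filter_upwards [h0] with δ hδ
      simp [F, hδ]
    simpa using this.const_mul α
  refine tendsto_order.2 ⟨fun a ha => Eventually.of_forall fun n =>
    ha.trans_le (condFDR_nonneg _ _ _ _), fun η hη => ?_⟩
  obtain ⟨δ, hδη, hδ⟩ :=
    ((hlim.eventually_lt_const (half_pos hη)).and self_mem_nhdsWithin).exists
  filter_upwards [(tendsto_measureReal_lt_lsuIndex hν hα0 hα hs hζ hc
    (mem_Ioi.1 hδ)).eventually_lt_const (half_pos hη), eventually_gt_atTop 0] with n hn hn0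
  have hn' : (0 : ℝ) < n := by exact_mod_cast hn0
  have hFc : ∀ i : Fin n, Integrable (fun x : Fin n → ℝ => F δ (x i))
      (Measure.pi fun _ : Fin n => gaussianReal 0 1) := fun i =>
    (measurePreserving_eval (fun _ : Fin n => gaussianReal 0 1) i).integrable_comp_of_integrable
      (hFi δ)
  have hgi : Integrable (fun x : Fin n → ℝ => α / n * ∑ i, F δ (x i))
      (Measure.pi fun _ : Fin n => gaussianReal 0 1) :=
    (integrable_finsetSum _ fun i _ => hFc i).const_mul _
  have key := integral_le_add_measureReal (μ := Measure.pi fun _ : Fin n => gaussianReal 0 1)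
    (E := {x | δ * n < lsuIndex α (pValue ν (ϑ n) (s, x))})
    (measurable_fdp_pValue_mk ν α (ϑ n) s) hgi
    (fun x => mul_nonneg (by positivity) (Finset.sum_nonneg fun i _ => hF0 _ _))
    (fun x => fdp_nonneg _ _ _) (fun x => fdp_le_one _ _ _) fun x hx => by
      refine (fdp_le_sum_inv hα0 (fun i hi => ?_) (not_lt.1 hx)).trans ?_
      · rw [pValue_of_mem_trueNulls ν s x hi]
        exact tTail_pos hν _
      · refine mul_le_mul_of_nonneg_left ?_ (by positivity)
        refine (le_of_eq (Finset.sum_congr rfl fun i hi => ?_)).trans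
          (Finset.sum_le_sum_of_subset_of_nonneg (f := fun i => F δ (x i))
            (Finset.subset_univ (trueNulls (ϑ n))) fun i _ _ => hF0 _ _)
        rw [pValue_of_mem_trueNulls ν s x hi]
  have hint : ∫ x : Fin n → ℝ, α / n * ∑ i, F δ (x i)
      ∂(Measure.pi fun _ : Fin n => gaussianReal 0 1) = α * ∫ y, F δ y ∂gaussianReal 0 1 := by
    rw [integral_const_mul, integral_finsetSum _ fun i _ => hFc i]
    have : ∀ i : Fin n, ∫ x : Fin n → ℝ, F δ (x i)
        ∂(Measure.pi fun _ : Fin n => gaussianReal 0 1) = ∫ y, F δ y ∂gaussianReal 0 1 := fun i =>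
      integral_comp_eval (μ := fun _ : Fin n => gaussianReal 0 1) (hFm δ).aestronglyMeasurable
    simp only [this, Finset.sum_const, Finset.card_univ, Fintype.card_fin, nsmul_eq_mul]
    field_simp
  rw [hint] at key
  change condFDR ν α (ϑ n) s ≤ _ at key
  linarith

end Conditional

/-! ### The rejection region and the limit for fixed `ν` -/

/-- The values of `S` for which the linear step-up procedure asymptotically rejects a positive
proportion of the true null hypotheses. -/
def rejectionRegion (ν α : ℝ) : Set ℝ :=
  {s | 0 < s ∧ ∃ c, 0 ≤ c ∧ tTail ν c < α * normTail (c * s)}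

/-- The limiting false discovery rate. -/
def limitFDR (α ν : ℝ) : ℝ := (lawS ν).real (rejectionRegion ν α)

variable {ν α : ℝ}

/-- Decreasing `s` turns the weak inequality defining the boundary curve into a strict one. -/
lemma mem_rejectionRegion_of_lt (hν : 0 < ν) (hα0 : 0 < α) (hα : α ≤ 1 / 2) {r s c : ℝ}
    (hr : 0 < r) (hrs : r < s) (hc : 0 ≤ c) (h : tTail ν c ≤ α * normTail (c * s)) :
    r ∈ rejectionRegion ν α := by
  refine ⟨hr, c, hc, h.trans_lt (mul_lt_mul_of_pos_left (normTail_strictAnti ?_) hα0)⟩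
  refine mul_lt_mul_of_pos_left hrs (hc.lt_of_ne ?_)
  -- At `c = 0` both tails equal `1 / 2`, so the inequality would force `α ≥ 1`.
  rintro rfl
  rw [zero_mul, tTail_zero hν, normTail_zero] at h
  linarith

lemma measurableSet_rejectionRegion (hν : 0 < ν) (hα0 : 0 < α) (hα : α ≤ 1 / 2) :
    MeasurableSet (rejectionRegion ν α) := by
  refine OrdConnected.measurableSet ⟨fun r hr s hs u hu => ?_⟩
  rcases hu.2.lt_or_eq with h | h
  · obtain ⟨_, c, hc, hlt⟩ := hs
    exact mem_rejectionRegion_of_lt hν hα0 hα (hr.1.trans_le hu.1) h hc hlt.le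
  · exact h ▸ hs

/-- For almost all `s` outside the rejection region the defining inequality is strictly reversed. -/
lemma ae_lt_tTail_of_notMem (hν : 0 < ν) (hα0 : 0 < α) (hα : α ≤ 1 / 2) :
    ∀ᵐ s ∂lawS ν, s ∉ rejectionRegion ν α → ∀ c, 0 ≤ c → α * normTail (c * s) < tTail ν c := by
  let N : Set ℝ := {s | 0 < s ∧ s ∉ rejectionRegion ν α ∧
    ∃ c, 0 ≤ c ∧ tTail ν c ≤ α * normTail (c * s)}
  -- The larger of two boundary values would put the smaller one inside the region.
  have hN : N.Subsingleton := by
    intro r hr s hs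
    by_contra hne
    rcases lt_or_gt_of_ne hne with h | h
    · obtain ⟨c, hc, hle⟩ := hs.2.2
      exact hr.2.1 (mem_rejectionRegion_of_lt hν hα0 hα hr.1 h hc hle)
    · obtain ⟨c, hc, hle⟩ := hr.2.2
      exact hs.2.1 (mem_rejectionRegion_of_lt hν hα0 hα hs.1 h hc hle)
  have hN0 : lawS ν N = 0 := by
    rcases hN.eq_empty_or_singleton with h | ⟨s, h⟩
    · rw [h, measure_empty]
    · rw [h, lawS_singleton hν]
  filter_upwards [lawS_ae_pos hν, measure_eq_zero_iff_ae_notMem.1 hN0] with s hs hsN hsB c hc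
  by_contra hle
  exact hsN ⟨hs, hsB, c, hc, not_lt.1 hle⟩

/-- Dominated convergence over `s`: the conditional rates converge almost surely to the indicator of
the region. -/
theorem isLimitingFDROne_limitFDR (hν : 0 < ν) (hα0 : 0 < α) (hα : α ≤ 1 / 2) :
    IsLimitingFDROne ν α (limitFDR α ν) := by
  intro ϑ hϑ hζ
  have := isProbabilityMeasure_lawS hν
  have hB := measurableSet_rejectionRegion hν hα0 hα
  simp_rw [fun n => FDR_eq_integral_condFDR hν α (hϑ n)]
  rw [limitFDR, ← integral_indicator_one hB]
  refine tendsto_integral_of_dominated_convergence (fun _ => 1) (fun n => ?_)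
    (integrable_const _) (fun n => ae_of_all _ fun s => ?_) ?_
  · exact ((measurable_fdp_pValue ν α (ϑ n)).stronglyMeasurable.integral_prod_right').aestronglyMeasurable
  · rw [Real.norm_of_nonneg (condFDR_nonneg _ _ _ _)]
    exact condFDR_le_one _ _ _ _
  · filter_upwards [lawS_ae_pos hν, ae_lt_tTail_of_notMem hν hα0 hα] with s hs hout
    by_cases h : s ∈ rejectionRegion ν α
    · rw [indicator_of_mem h]
      obtain ⟨_, c, _, hc⟩ := h
      exact tendsto_condFDR_one hν hα0 hs hζ hc
    · rw [indicator_of_notMem h]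
      exact tendsto_condFDR_zero hν hα0 hα hs hζ (hout h)

/-! ### Normal approximation of the Gamma law -/

section LogAsymptotics

lemma sqrt_mul_eq (a v : ℝ) : √a * v = a * (v / √a) := by
  rw [mul_div_left_comm, Real.div_sqrt, mul_comm]

lemma one_add_div_sqrt_pos {a v : ℝ} (ha : 0 < √a) (hv : -√a < v) : 0 < 1 + v / √a := by
  have : -1 < v / √a := by rw [lt_div_iff₀ ha]; linarith
  linarith

/-- This is `log y ≤ y - 1` at `y = √(1 + x)`. The bound is valid on the whole domain, quadratic
near 0 and linear at infinity. -/
lemma log_one_add_sub_le {x : ℝ} (hx : -1 < x) :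
    Real.log (1 + x) - x ≤ -(√(1 + x) - 1) ^ 2 := by
  have h : 0 < 1 + x := by linarith
  have h1 := Real.log_le_sub_one_of_pos (Real.sqrt_pos.2 h)
  rw [Real.log_sqrt h.le] at h1
  have h2 := Real.sq_sqrt h.le
  nlinarith

/-- With `w = √(1 + v / √a)` and `D = √a * |w - 1|`, the left side is at most `-D ^ 2` and `|v| ≤ 2
* D + D ^ 2`. The resulting exponential majorant does not depend on `a`. -/
lemma mul_log_one_add_sub_le {a v : ℝ} (ha : 1 ≤ a) (hv : -√a < v) :
    a * (Real.log (1 + v / √a) - v / √a) ≤ 1 - |v| / 2 := by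
  have hr : 1 ≤ √a := Real.one_le_sqrt.2 ha
  have hr0 : 0 < √a := by linarith
  have hx : -1 < v / √a := by linarith [one_add_div_sqrt_pos hr0 hv]
  have h := mul_le_mul_of_nonneg_left (log_one_add_sub_le hx) (by linarith : 0 ≤ a)
  refine h.trans ?_
  set w := √(1 + v / √a) with hw
  have hw0 : 0 ≤ w := Real.sqrt_nonneg _
  have hw2 : w ^ 2 = 1 + v / √a := Real.sq_sqrt (by linarith)
  have hv2 : v = √a * ((w - 1) * (w + 1)) := by
    have : (w - 1) * (w + 1) = v / √a := by linear_combination hw2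
    rw [this]; field_simp
  have habs : |v| = √a * (|w - 1| * (w + 1)) := by
    conv_lhs => rw [hv2]
    rw [abs_mul, abs_mul, abs_of_pos hr0, abs_of_nonneg (by linarith : 0 ≤ w + 1)]
  have ha2 : a = √a ^ 2 := (Real.sq_sqrt (by linarith)).symm
  rw [habs, ← sq_abs (w - 1)]
  have hd : 0 ≤ |w - 1| := abs_nonneg _
  have hwd : w + 1 ≤ 2 + |w - 1| := by linarith [le_abs_self (w - 1)]
  have h1 : √a * (|w - 1| * (w + 1)) ≤ √a * (|w - 1| * (2 + |w - 1|)) := by gcongr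
  have h2 : √a * |w - 1| ^ 2 ≤ √a ^ 2 * |w - 1| ^ 2 := by
    refine mul_le_mul_of_nonneg_right ?_ (by positivity)
    nlinarith
  rw [mul_neg, show a * |w - 1| ^ 2 = √a ^ 2 * |w - 1| ^ 2 by rw [← ha2]]
  nlinarith [sq_nonneg (√a * |w - 1| - 1)]

/-- With `x = v / √a > -1`, the left side is `(a - b) * (log (1 + x) - x) - b * x`. Here `a - b ≥ a
/ 2` and `-b * x ≤ 2`, whence `5 / 2 = 1 / 2 + 2`. The case `b = 1` is the density, `b = 2` the
density divided by `1 + x`. -/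
lemma sub_mul_log_sub_le {a b v : ℝ} (ha : 4 ≤ a) (hb0 : 0 ≤ b) (hb : b ≤ 2) (hv : -√a < v) :
    (a - b) * Real.log (1 + v / √a) - √a * v ≤ 5 / 2 - |v| / 4 := by
  have hr0 : 0 < √a := Real.sqrt_pos.2 (by linarith)
  have hx : -1 < v / √a := by linarith [one_add_div_sqrt_pos hr0 hv]
  have h1 := mul_log_one_add_sub_le (by linarith : 1 ≤ a) hv
  have h2 : Real.log (1 + v / √a) - v / √a ≤ 0 :=
    (log_one_add_sub_le hx).trans (neg_nonpos.2 (sq_nonneg _))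
  rw [sqrt_mul_eq]
  nlinarith

lemma tendsto_mul_log_one_add_sub (v : ℝ) :
    Tendsto (fun a : ℝ => a * (Real.log (1 + v / √a) - v / √a)) atTop (𝓝 (-v ^ 2 / 2)) := by
  have h0 : Tendsto (fun a : ℝ => 2 * |v| ^ 3 * (√a)⁻¹) atTop (𝓝 0) := by
    have := (tendsto_inv_atTop_zero.comp Real.tendsto_sqrt_atTop).const_mul (2 * |v| ^ 3)
    rwa [mul_zero] at this
  rw [tendsto_iff_norm_sub_tendsto_zero]
  refine squeeze_zero' (Eventually.of_forall fun _ => norm_nonneg _) ?_ h0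
  filter_upwards [Real.tendsto_sqrt_atTop.eventually_ge_atTop (2 * |v| + 1),
    eventually_gt_atTop 0] with a ha ha0
  have hr0 : 0 < √a := Real.sqrt_pos.2 ha0
  have hx : |(-(v / √a))| ≤ 1 / 2 := by
    rw [abs_neg, abs_div, abs_of_pos hr0, div_le_iff₀ hr0]; linarith
  have h := Real.abs_log_sub_add_sum_range_le (hx.trans_lt (by norm_num)) 2
  simp only [Finset.sum_range_succ, Finset.sum_range_zero] at h
  have h2 : |(-(v / √a))| ^ (2 + 1) / (1 - |(-(v / √a))|) ≤ 2 * |(-(v / √a))| ^ 3 := by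
    rw [div_le_iff₀ (by linarith)]
    nlinarith [pow_nonneg (abs_nonneg (-(v / √a))) 3]
  have h3 := mul_le_mul_of_nonneg_left (h.trans h2) ha0.le
  rw [← abs_of_pos ha0, ← abs_mul, abs_of_pos ha0] at h3
  have ha2 : a = √a * √a := (Real.mul_self_sqrt ha0.le).symm
  rw [Real.norm_eq_abs]
  refine le_trans (le_of_eq ?_) (h3.trans (le_of_eq ?_))
  · congr 1
    have : a * (v / √a) ^ 2 = v ^ 2 := by
      rw [div_pow, Real.sq_sqrt ha0.le]; field_simp
    norm_num
    linear_combination (-1 / 2 : ℝ) * this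
  · rw [abs_neg, abs_div, abs_of_pos hr0]
    nth_rewrite 1 [ha2]
    field_simp

end LogAsymptotics

/-- The density of `√a (U - 1)`, with `U` Gamma distributed of shape and rate `a`, up to a
constant. -/
def stdGammaDensity (a v : ℝ) : ℝ :=
  if -√a < v then Real.exp ((a - 1) * Real.log (1 + v / √a) - √a * v) else 0

lemma measurable_stdGammaDensity (a : ℝ) : Measurable (stdGammaDensity a) :=
  Measurable.ite measurableSet_Ioi (by fun_prop) measurable_const

lemma stdGammaDensity_nonneg (a v : ℝ) : 0 ≤ stdGammaDensity a v := by
  unfold stdGammaDensity; split_ifs <;> positivity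

lemma exp_sub_abs_le (v : ℝ) :
    Real.exp (5 / 2 - |v| / 4) ≤ 33 * Real.exp (5 / 2) * (1 + v ^ 2)⁻¹ := by
  have h := Real.quadratic_le_exp_of_nonneg (show 0 ≤ |v| / 4 by positivity)
  rw [Real.exp_sub, ← div_eq_mul_inv, div_le_div_iff₀ (Real.exp_pos _) (by positivity)]
  have h2 : 1 + v ^ 2 ≤ 33 * Real.exp (|v| / 4) := by
    rw [← sq_abs v]
    nlinarith [abs_nonneg v]
  nlinarith [Real.exp_pos (5 / 2 : ℝ)]

/-- The weight corresponds to `1 + S⁻²`, which controls the unbounded test function `max 1 (1 / t)`.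
-/
lemma mul_stdGammaDensity_le {a v : ℝ} (ha : 4 ≤ a) :
    (1 + (1 + v / √a)⁻¹) * stdGammaDensity a v
      ≤ 66 * Real.exp (5 / 2) * (1 + v ^ 2)⁻¹ := by
  unfold stdGammaDensity
  split_ifs with hv
  · have hr0 : 0 < √a := Real.sqrt_pos.2 (by linarith)
    have hx : 0 < 1 + v / √a := one_add_div_sqrt_pos hr0 hv
    have h1 := Real.exp_le_exp.2 (sub_mul_log_sub_le ha zero_le_one one_le_two hv)
    have h2 := Real.exp_le_exp.2 (sub_mul_log_sub_le ha zero_le_two le_rfl hv)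
    have e : (1 + v / √a)⁻¹ * Real.exp ((a - 1) * Real.log (1 + v / √a) - √a * v)
        = Real.exp ((a - 2) * Real.log (1 + v / √a) - √a * v) := by
      have : (1 + v / √a)⁻¹ = Real.exp (-Real.log (1 + v / √a)) := by
        rw [Real.exp_neg, Real.exp_log hx]
      rw [this, ← Real.exp_add]; congr 1; ring
    rw [add_mul, one_mul, e]
    linarith [exp_sub_abs_le v]
  · rw [mul_zero]; positivity

lemma tendsto_div_sqrt (v : ℝ) : Tendsto (fun a : ℝ => v / √a) atTop (𝓝 0) :=
  tendsto_const_nhds.div_atTop Real.tendsto_sqrt_atTop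

lemma tendsto_stdGammaDensity (v : ℝ) :
    Tendsto (fun a => stdGammaDensity a v) atTop (𝓝 (Real.exp (-v ^ 2 / 2))) := by
  have h1 : Tendsto (fun a => Real.log (1 + v / √a)) atTop (𝓝 0) := by
    have := ((tendsto_div_sqrt v).const_add 1).log (by norm_num)
    simpa using this
  have h2 := (tendsto_mul_log_one_add_sub v).sub h1
  rw [sub_zero] at h2
  refine ((Real.continuous_exp.tendsto _).comp h2).congr' ?_
  filter_upwards [Real.tendsto_sqrt_atTop.eventually_gt_atTop (-v),
    eventually_gt_atTop 0] with a ha ha0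
  have hr0 : 0 < √a := Real.sqrt_pos.2 ha0
  rw [stdGammaDensity, if_pos (by linarith), Function.comp]
  congr 1
  rw [sqrt_mul_eq]; ring

lemma integral_exp_neg_sq_half_mul (H : ℝ → ℝ) :
    ∫ v, H v * Real.exp (-v ^ 2 / 2) = √(2 * Real.pi) * ∫ v, H v ∂gaussianReal 0 1 := by
  rw [integral_gaussianReal_eq_integral_smul one_ne_zero, ← integral_const_mul]
  congr 1 with v
  simp only [gaussianPDFReal, NNReal.coe_one, mul_one, sub_zero, smul_eq_mul]
  have : √(2 * Real.pi) ≠ 0 := by positivity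
  field_simp

lemma tendsto_integral_mul_stdGammaDensity {h : ℝ → ℝ → ℝ} {H : ℝ → ℝ} {C : ℝ}
    (hm : ∀ a, Measurable (h a))
    (hb : ∀ᶠ a in atTop, ∀ v, -√a < v → |h a v| ≤ C * (1 + (1 + v / √a)⁻¹))
    (hlim : ∀ᵐ v, Tendsto (fun a => h a v) atTop (𝓝 (H v))) :
    Tendsto (fun a => ∫ v, h a v * stdGammaDensity a v) atTop
      (𝓝 (√(2 * Real.pi) * ∫ v, H v ∂gaussianReal 0 1)) := by
  rw [← integral_exp_neg_sq_half_mul]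
  refine tendsto_integral_filter_of_dominated_convergence
    (fun v => |C| * (66 * Real.exp (5 / 2) * (1 + v ^ 2)⁻¹))
    (Eventually.of_forall fun a =>
      ((hm a).mul (measurable_stdGammaDensity a)).aestronglyMeasurable) ?_
    ((integrable_inv_one_add_sq.const_mul _).const_mul _) ?_
  · filter_upwards [hb, eventually_ge_atTop 4] with a hba ha
    refine ae_of_all _ fun v => ?_
    rw [norm_mul, Real.norm_of_nonneg (stdGammaDensity_nonneg a v), Real.norm_eq_abs]
    by_cases hv : -√a < v
    · have hr0 : 0 < √a := Real.sqrt_pos.2 (by linarith)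
      have hx : 0 < 1 + v / √a := one_add_div_sqrt_pos hr0 hv
      calc |h a v| * stdGammaDensity a v
          ≤ (|C| * (1 + (1 + v / √a)⁻¹)) * stdGammaDensity a v := by
            refine mul_le_mul_of_nonneg_right ((hba v hv).trans ?_) (stdGammaDensity_nonneg a v)
            exact mul_le_mul_of_nonneg_right (le_abs_self C) (by positivity)
        _ = |C| * ((1 + (1 + v / √a)⁻¹) * stdGammaDensity a v) := by ring
        _ ≤ _ := mul_le_mul_of_nonneg_left (mul_stdGammaDensity_le ha) (abs_nonneg C)
    · rw [stdGammaDensity, if_neg hv, mul_zero]; positivity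
  · filter_upwards [hlim] with v hv
    exact hv.mul (tendsto_stdGammaDensity v)

/-- Substitution `u = 1 + v / √(ν / 2)` in the law of `S ^ 2`. The constant may stay anonymous
because the test function 1 determines it. -/
lemma exists_integral_lawS_eq {ν : ℝ} (hν : 0 < ν) : ∃ K : ℝ, ∀ h : ℝ → ℝ, Measurable h →
    ∫ s, h s ∂lawS ν = K * ∫ v, h √(1 + v / √(ν / 2)) * stdGammaDensity (ν / 2) v := by
  set a := ν / 2 with ha
  have ha0 : 0 < a := by positivity
  have hr0 : 0 < √a := Real.sqrt_pos.2 ha0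
  refine ⟨a ^ a / Real.Gamma a * ((√a)⁻¹ * Real.exp (-a)), fun h hh => ?_⟩
  rw [integral_lawS hν hh, ← ha, mul_assoc, ← integral_indicator measurableSet_Ioi]
  congr 1
  set G : ℝ → ℝ := (Ioi (0 : ℝ)).indicator
    fun u => h √u * (u ^ (a - 1) * Real.exp (-(a * u))) with hG
  have h1 : ∫ v, G (1 + v / √a) = √a * ∫ u, G u := by
    have h2 := Measure.integral_comp_div (fun y => G (1 + y)) (√a)
    rw [integral_add_left_eq_self G 1, abs_of_pos hr0, smul_eq_mul] at h2
    exact h2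
  have h3 : ∀ v, G (1 + v / √a) = Real.exp (-a) * (h √(1 + v / √a) * stdGammaDensity a v) := by
    intro v
    by_cases hv : -√a < v
    · have hx : 0 < 1 + v / √a := one_add_div_sqrt_pos hr0 hv
      have hmem : 1 + v / √a ∈ Ioi (0 : ℝ) := hx
      rw [hG, indicator_of_mem hmem, stdGammaDensity, if_pos hv, Real.rpow_def_of_pos hx,
        ← Real.exp_add, mul_left_comm, ← Real.exp_add]
      congr 2
      rw [sqrt_mul_eq]; ring
    · have hx : 1 + v / √a ∉ Ioi (0 : ℝ) := by
        rw [mem_Ioi, not_lt]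
        have : v / √a ≤ -1 := by rw [div_le_iff₀ hr0]; linarith
        linarith
      rw [hG, indicator_of_notMem hx, stdGammaDensity, if_neg hv, mul_zero, mul_zero]
  simp_rw [h3] at h1
  rw [integral_const_mul] at h1
  rw [mul_assoc, h1]
  field_simp

/-- Convergence of expectations under the normal approximation of `S²`. -/
theorem tendsto_integral_lawS {h : ℝ → ℝ → ℝ} {H : ℝ → ℝ} {C : ℝ} (hm : ∀ ν, Measurable (h ν))
    (hb : ∀ᶠ ν in atTop, ∀ s, 0 < s → |h ν s| ≤ C * (1 + (s ^ 2)⁻¹))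
    (hlim : ∀ᵐ v, Tendsto (fun ν => h ν √(1 + v / √(ν / 2))) atTop (𝓝 (H v))) :
    Tendsto (fun ν => ∫ s, h ν s ∂lawS ν) atTop (𝓝 (∫ v, H v ∂gaussianReal 0 1)) := by
  have h2 : Tendsto (fun a : ℝ => 2 * a) atTop atTop := tendsto_id.const_mul_atTop two_pos
  have hhalf : Tendsto (fun ν : ℝ => ν / 2) atTop atTop := tendsto_id.atTop_div_const two_pos
  have hπ : √(2 * Real.pi) ≠ 0 := by positivity
  have hnum : Tendsto (fun ν => ∫ v, h ν √(1 + v / √(ν / 2)) * stdGammaDensity (ν / 2) v) atTop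
      (𝓝 (√(2 * Real.pi) * ∫ v, H v ∂gaussianReal 0 1)) := by
    have key := tendsto_integral_mul_stdGammaDensity
      (h := fun a v => h (2 * a) √(1 + v / √a)) (H := H) (C := C)
      (fun a => (hm _).comp (by fun_prop)) ?_ ?_
    · refine (key.comp hhalf).congr fun ν => ?_
      simp only [Function.comp]
      rw [mul_div_cancel₀ ν two_ne_zero]
    · filter_upwards [h2.eventually hb, eventually_gt_atTop 0] with a ha ha0 v hv
      have hr0 : 0 < √a := Real.sqrt_pos.2 ha0
      have hx : 0 < 1 + v / √a := one_add_div_sqrt_pos hr0 hv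
      have := ha _ (Real.sqrt_pos.2 hx)
      rwa [Real.sq_sqrt hx.le] at this
    · filter_upwards [hlim] with v hv
      refine (hv.comp h2).congr fun a => ?_
      simp only [Function.comp]
      rw [mul_div_cancel_left₀ a two_ne_zero]
  -- The same limit for the test function 1; dividing by it cancels the normalising constant, with
  -- no need for Stirling's formula.
  have hden : Tendsto (fun ν => ∫ v, stdGammaDensity (ν / 2) v) atTop
      (𝓝 (√(2 * Real.pi))) := by
    have key := tendsto_integral_mul_stdGammaDensity (h := fun _ _ => 1) (H := fun _ => 1) (C := 1)
      (fun a => measurable_const) ?_ (ae_of_all _ fun v => tendsto_const_nhds)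
    · simp only [one_mul, integral_const, probReal_univ, smul_eq_mul, mul_one] at key
      exact key.comp hhalf
    · filter_upwards [eventually_gt_atTop 0] with a ha0 v hv
      have hr0 : 0 < √a := Real.sqrt_pos.2 ha0
      have hx : 0 < 1 + v / √a := one_add_div_sqrt_pos hr0 hv
      simp only [abs_one, one_mul, le_add_iff_nonneg_right]
      positivity
  have hdiv := hnum.div hden hπ
  rw [mul_div_cancel_left₀ _ hπ] at hdiv
  refine hdiv.congr' ?_
  filter_upwards [eventually_gt_atTop 0] with ν hν
  have := isProbabilityMeasure_lawS hν
  obtain ⟨K, hK⟩ := exists_integral_lawS_eq hν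
  have h1 := hK (fun _ => 1) measurable_const
  simp only [integral_const, probReal_univ, smul_eq_mul, one_mul, mul_one] at h1
  have hne : ∫ v, stdGammaDensity (ν / 2) v ≠ 0 := fun h0 => by
    rw [h0, mul_zero] at h1; exact one_ne_zero h1
  rw [hK _ (hm ν), Pi.div_apply, div_eq_iff hne, mul_right_comm, ← h1, one_mul]

/-! ### Bounds on the `t`-tail by exponential tilting -/

section Tilting

variable {ν : ℝ}

/-- Exponential tilting of the law of `S` amounts to rescaling. -/
lemma integral_lawS_mul_exp (hν : 0 < ν) {h : ℝ → ℝ} (hh : Measurable h) {θ m : ℝ} (hm : 0 < m)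
    (hθ : ν / 2 + θ = ν / 2 / m) :
    ∫ s, h s * Real.exp (-(θ * s ^ 2)) ∂lawS ν = m ^ (ν / 2) * ∫ s, h (√m * s) ∂lawS ν := by
  rw [integral_lawS hν (by fun_prop), integral_lawS hν (h := fun s => h (√m * s)) (by fun_prop),
    mul_left_comm]
  congr 1
  have key := integral_comp_mul_left_Ioi (fun u : ℝ => h √u * Real.exp (-(θ * √u ^ 2))
    * (u ^ (ν / 2 - 1) * Real.exp (-(ν / 2 * u)))) 0 hm
  rw [mul_zero, smul_eq_mul, eq_inv_mul_iff_mul_eq₀ hm.ne'] at key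
  rw [← key, ← integral_const_mul, ← integral_const_mul]
  refine setIntegral_congr_fun measurableSet_Ioi fun u hu => ?_
  have hu : 0 < u := hu
  rw [Real.sqrt_mul hm.le, mul_pow, Real.sq_sqrt hm.le, Real.sq_sqrt hu.le,
    Real.mul_rpow hm.le hu.le, Real.rpow_sub_one hm.ne']
  have e : Real.exp (-(θ * (m * u))) * Real.exp (-(ν / 2 * (m * u))) = Real.exp (-(ν / 2 * u)) := by
    rw [← Real.exp_add]
    congr 1
    have : (ν / 2 + θ) * m = ν / 2 := by rw [hθ]; field_simp
    linear_combination (-u) * this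
  rw [← e]
  field_simp

lemma measurable_min_div (s : ℝ) : Measurable fun t : ℝ => min 1 (s / t) := by fun_prop

lemma integrable_min_div (hν : 0 < ν) {s : ℝ} (hs : 0 ≤ s) :
    Integrable (fun t => min 1 (s / t)) (lawS ν) := by
  have := isProbabilityMeasure_lawS hν
  refine Integrable.of_bound (C := 1) (measurable_min_div s).aestronglyMeasurable ?_
  filter_upwards [lawS_ae_pos hν] with t ht
  rw [Real.norm_of_nonneg (le_min zero_le_one (by positivity))]
  exact min_le_left _ _

/-- A lower bound for the tail of the `t`-distribution, uniform in `c`. -/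
lemma mul_normTail_le_tTail (hν : 0 < ν) {c s : ℝ} (hc : 0 ≤ c) (hs : 0 < s) :
    (Real.exp (ν / 2 * (1 - s ^ 2 + Real.log (s ^ 2))) * ∫ t, min 1 (s / t) ∂lawS ν)
      * normTail (c * s) ≤ tTail ν c := by
  have hprob := isProbabilityMeasure_lawS hν
  set θ := c ^ 2 / 2 with hθ
  have hθ0 : 0 ≤ θ := by positivity
  -- Tilting by `exp (-(θ * S ^ 2))` shrinks `S ^ 2` by the factor `m ≤ 1`, which only increases
  -- `min 1 (s / t)`.
  set m := ν / 2 / (ν / 2 + θ) with hm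
  have hm0 : 0 < m := by positivity
  have hm1 : m ≤ 1 := div_le_one_of_le₀ (by linarith) (by positivity)
  have hmθ : ν / 2 + θ = ν / 2 / m := by rw [hm]; field_simp
  have hEm : ∀ t, Real.exp (-(θ * (t ^ 2 - s ^ 2)))
      = Real.exp (θ * s ^ 2) * Real.exp (-(θ * t ^ 2)) := fun t => by
    rw [← Real.exp_add]; congr 1; ring
  have hint : Integrable (fun t => min 1 (s / t) * Real.exp (-(θ * (t ^ 2 - s ^ 2)))) (lawS ν) := by
    refine Integrable.of_bound (C := Real.exp (θ * s ^ 2)) (by fun_prop) ?_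
    filter_upwards [lawS_ae_pos hν] with t ht
    rw [Real.norm_of_nonneg (mul_nonneg (le_min zero_le_one (by positivity)) (Real.exp_pos _).le)]
    refine (mul_le_of_le_one_left (Real.exp_pos _).le (min_le_left _ _)).trans
      (Real.exp_le_exp.2 ?_)
    nlinarith [mul_nonneg hθ0 (sq_nonneg t)]
  have h1 : (∫ t, min 1 (s / t) * Real.exp (-(θ * (t ^ 2 - s ^ 2))) ∂lawS ν) * normTail (c * s)
      ≤ tTail ν c := by
    rw [tTail_eq_integral hν, ← integral_mul_const]
    refine integral_mono_ae (hint.mul_const _) (integrable_normTail_mul hν c) ?_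
    filter_upwards [lawS_ae_pos hν] with t ht
    exact min_mul_normTail_le hc hs ht
  refine le_trans (mul_le_mul_of_nonneg_right ?_ (normTail_nonneg _)) h1
  have h2 : ∫ t, min 1 (s / t) * Real.exp (-(θ * (t ^ 2 - s ^ 2))) ∂lawS ν
      = Real.exp (θ * s ^ 2) * m ^ (ν / 2) * ∫ t, min 1 (s / (√m * t)) ∂lawS ν := by
    rw [mul_assoc, ← integral_lawS_mul_exp hν (measurable_min_div s) hm0 hmθ, ← integral_const_mul]
    congr 1 with t
    rw [hEm]; ring
  rw [h2]
  refine mul_le_mul ?_ ?_ ?_ (by positivity)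
  · rw [Real.rpow_def_of_pos hm0, ← Real.exp_add]
    refine Real.exp_le_exp.2 ?_
    -- This minimises the tilted mass over `θ`; equality holds at `m = s ^ 2`, the value used for
    -- the upper bound on the tail.
    have hlog := Real.log_le_sub_one_of_pos (show 0 < s ^ 2 / m by positivity)
    rw [Real.log_div (by positivity) hm0.ne'] at hlog
    have hlog2 := mul_le_mul_of_nonneg_left hlog (by positivity : 0 ≤ ν / 2)
    have e : ν / 2 * (s ^ 2 / m - 1) = (ν / 2 + θ) * s ^ 2 - ν / 2 := by
      rw [hmθ]; ring
    rw [e] at hlog2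
    linarith
  · have hsm : 0 < √m := Real.sqrt_pos.2 hm0
    refine integral_mono_ae (integrable_min_div hν hs.le) ?_ ?_
    · have := integrable_min_div hν (div_nonneg hs.le hsm.le)
      simpa only [div_div] using this
    · filter_upwards [lawS_ae_pos hν] with t ht
      refine min_le_min le_rfl (div_le_div_of_nonneg_left hs.le (by positivity) ?_)
      exact mul_le_of_le_one_left ht.le (Real.sqrt_le_one.2 hm1)
  · refine integral_nonneg_of_ae ?_
    filter_upwards [lawS_ae_pos hν] with t ht
    exact le_min zero_le_one (by positivity)

/-- An upper bound for the tail of the `t`-distribution at a suitable point. -/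
lemma exists_tTail_le_mul_normTail (hν : 0 < ν) {s : ℝ} (hs : 0 < s) (hs1 : s < 1)
    (hI : ∫ t, max 1 (1 / t) ∂lawS ν ≠ 0) :
    ∃ c, 0 ≤ c ∧ tTail ν c ≤
      (Real.exp (ν / 2 * (1 - s ^ 2 + Real.log (s ^ 2))) * ∫ t, max 1 (1 / t) ∂lawS ν)
        * normTail (c * s) := by
  have hprob := isProbabilityMeasure_lawS hν
  have hs2 : s ^ 2 ≤ 1 := pow_le_one₀ hs.le hs1.le
  -- The optimal tilt, with shrinking factor exactly `s ^ 2`; `s < 1` makes it nonnegative, so that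
  -- `c = √(2 * θ)` exists.
  set θ := ν / 2 / s ^ 2 - ν / 2 with hθ
  have hθ0 : 0 ≤ θ := by
    rw [hθ, sub_nonneg, le_div_iff₀ (by positivity)]
    exact mul_le_of_le_one_right (by positivity) hs2
  have hmθ : ν / 2 + θ = ν / 2 / s ^ 2 := by rw [hθ]; ring
  have hc2 : √(2 * θ) ^ 2 / 2 = θ := by
    rw [Real.sq_sqrt (by positivity)]; ring
  have h2 : ∫ t, max 1 (s / t) * Real.exp (-(θ * (t ^ 2 - s ^ 2))) ∂lawS ν
      = Real.exp (ν / 2 * (1 - s ^ 2 + Real.log (s ^ 2))) * ∫ t, max 1 (1 / t) ∂lawS ν := by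
    have h3 := integral_lawS_mul_exp hν (h := fun t => max 1 (s / t)) (by fun_prop)
      (show 0 < s ^ 2 by positivity) hmθ
    have h4 : ∀ t, max 1 (s / (√(s ^ 2) * t)) = max 1 (1 / t) := fun t => by
      rw [Real.sqrt_sq hs.le]
      congr 1
      rw [div_mul_eq_div_div, div_self hs.ne']
    simp_rw [h4] at h3
    have e : Real.exp (ν / 2 * (1 - s ^ 2 + Real.log (s ^ 2)))
        = Real.exp (θ * s ^ 2) * (s ^ 2) ^ (ν / 2) := by
      rw [Real.rpow_def_of_pos (by positivity), ← Real.exp_add]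
      congr 1
      have : θ * s ^ 2 = ν / 2 - ν / 2 * s ^ 2 := by rw [hθ]; field_simp
      rw [this]; ring
    rw [e, mul_assoc, ← h3, ← integral_const_mul]
    congr 1 with t
    rw [mul_left_comm, ← Real.exp_add]
    congr 2; ring
  refine ⟨√(2 * θ), Real.sqrt_nonneg _, ?_⟩
  have hint : Integrable (fun t => max 1 (s / t) * Real.exp (-(θ * (t ^ 2 - s ^ 2)))) (lawS ν) := by
    -- A non-integrable function has Bochner integral 0 by convention, so the nonzero value computed
    -- in `h2` already gives integrability.
    refine Integrable.of_integral_ne_zero ?_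
    rw [h2]
    exact mul_ne_zero (Real.exp_ne_zero _) hI
  rw [← h2, tTail_eq_integral hν, ← integral_mul_const]
  refine integral_mono_ae (integrable_normTail_mul hν _) (hint.mul_const _) ?_
  filter_upwards [lawS_ae_pos hν] with t ht
  have := normTail_le_max_mul (Real.sqrt_nonneg (2 * θ)) hs ht
  rwa [hc2] at this

end Tilting

/-! ### The limit as `ν` tends to infinity -/

section LargeDegreesOfFreedom

/-- A value of `S` at distance `-x` from its mean, on the scale of the normal approximation. -/
def stdValue (ν x : ℝ) : ℝ := √(1 - x / √(ν / 2))

lemma tendsto_half_atTop : Tendsto (fun ν : ℝ => ν / 2) atTop atTop :=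
  tendsto_id.atTop_div_const two_pos

lemma tendsto_one_add_div_sqrt_half (v : ℝ) :
    Tendsto (fun ν : ℝ => 1 + v / √(ν / 2)) atTop (𝓝 1) := by
  have := ((tendsto_div_sqrt v).comp tendsto_half_atTop).const_add 1
  rwa [add_zero] at this

lemma tendsto_one_sub_div_sqrt_half (x : ℝ) :
    Tendsto (fun ν : ℝ => 1 - x / √(ν / 2)) atTop (𝓝 1) :=
  (tendsto_one_add_div_sqrt_half (-x)).congr fun ν => by ring

lemma tendsto_stdValue (x : ℝ) : Tendsto (fun ν => stdValue ν x) atTop (𝓝 1) := by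
  have := (tendsto_one_sub_div_sqrt_half x).sqrt
  rwa [Real.sqrt_one] at this

lemma tendsto_exp_stdValue (x : ℝ) :
    Tendsto (fun ν => Real.exp (ν / 2 * (1 - stdValue ν x ^ 2 + Real.log (stdValue ν x ^ 2)))) atTop
      (𝓝 (Real.exp (-x ^ 2 / 2))) := by
  have h := (tendsto_mul_log_one_add_sub (-x)).comp tendsto_half_atTop
  rw [neg_sq] at h
  refine (Real.continuous_exp.tendsto _).comp (h.congr' ?_)
  filter_upwards [(tendsto_one_sub_div_sqrt_half x).eventually_const_lt one_pos] with ν hν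
  rw [stdValue, Real.sq_sqrt hν.le, Function.comp]
  have : 1 + -x / √(ν / 2) = 1 - x / √(ν / 2) := by ring
  rw [this]; ring

lemma tendsto_integral_max : Tendsto (fun ν => ∫ t, max 1 (1 / t) ∂lawS ν) atTop (𝓝 1) := by
  have h := tendsto_integral_lawS (h := fun _ t => max 1 (1 / t)) (H := fun _ => 1) (C := 1)
    (fun _ => by fun_prop) (Eventually.of_forall fun _ s hs => ?_) (ae_of_all _ fun v => ?_)
  · simpa using h
  · rw [abs_of_nonneg (zero_le_one.trans (le_max_left _ _)), one_mul, one_div]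
    refine max_le (by simp; positivity) ?_
    rw [← inv_pow]
    nlinarith [sq_nonneg (s⁻¹ - 1), inv_pos.2 hs]
  · have h1 := (tendsto_one_add_div_sqrt_half v).sqrt
    rw [Real.sqrt_one] at h1
    have := (tendsto_const_nhds (x := (1 : ℝ))).max
      ((tendsto_const_nhds (x := (1 : ℝ))).div h1 one_ne_zero)
    simpa using this

lemma tendsto_integral_min (x : ℝ) :
    Tendsto (fun ν => ∫ t, min 1 (stdValue ν x / t) ∂lawS ν) atTop (𝓝 1) := by
  have h := tendsto_integral_lawS (h := fun ν t => min 1 (stdValue ν x / t)) (H := fun _ => 1)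
    (C := 1) (fun _ => measurable_min_div _) (Eventually.of_forall fun ν s hs => ?_)
    (ae_of_all _ fun v => ?_)
  · simpa using h
  · have : 0 ≤ stdValue ν x := Real.sqrt_nonneg _
    rw [abs_of_nonneg (le_min zero_le_one (by positivity)), one_mul]
    exact (min_le_left _ _).trans (by simp; positivity)
  · have h1 := (tendsto_one_add_div_sqrt_half v).sqrt
    rw [Real.sqrt_one] at h1
    have := (tendsto_const_nhds (x := (1 : ℝ))).min ((tendsto_stdValue x).div h1 one_ne_zero)
    simpa using this

/-- On the standardized scale the event `S ≤ stdValue ν x` is eventually just `v ≤ -x`. -/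
lemma tendsto_lawS_Iic_stdValue (x : ℝ) :
    Tendsto (fun ν => (lawS ν).real (Iic (stdValue ν x))) atTop (𝓝 (cdf (gaussianReal 0 1) (-x))) := by
  have h := tendsto_integral_lawS (h := fun ν => (Iic (stdValue ν x)).indicator 1)
    (H := (Iic (-x)).indicator 1) (C := 1) (fun _ => measurable_one.indicator measurableSet_Iic)
    (Eventually.of_forall fun ν s hs => ?_) ?_
  · rw [integral_indicator_one measurableSet_Iic, ← cdf_eq_real] at h
    exact h.congr fun ν => integral_indicator_one measurableSet_Iic
  · rw [abs_of_nonneg (indicator_nonneg (f := (1 : ℝ → ℝ)) (fun _ _ => zero_le_one) _), one_mul]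
    refine (indicator_le_self' (fun _ _ => zero_le_one) _).trans ?_
    simp only [le_add_iff_nonneg_right]
    positivity
  · refine ae_of_all _ fun v => tendsto_const_nhds.congr' ?_
    filter_upwards [(tendsto_one_sub_div_sqrt_half x).eventually_const_lt one_pos,
      eventually_gt_atTop 0] with ν hν hν0
    have hr : 0 < √(ν / 2) := Real.sqrt_pos.2 (by positivity)
    have hiff : √(1 + v / √(ν / 2)) ∈ Iic (stdValue ν x) ↔ v ∈ Iic (-x) := by
      rw [mem_Iic, mem_Iic, stdValue, Real.sqrt_le_sqrt_iff hν.le]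
      constructor
      · intro h
        have : v / √(ν / 2) ≤ -x / √(ν / 2) := by rw [neg_div]; linarith
        exact (div_le_div_iff_of_pos_right hr).1 this
      · intro h
        have := div_le_div_of_nonneg_right h hr.le
        rw [neg_div] at this
        linarith
    by_cases hv : v ∈ Iic (-x)
    · rw [indicator_of_mem hv, indicator_of_mem (hiff.2 hv)]; rfl
    · rw [indicator_of_notMem hv, indicator_of_notMem (mt hiff.1 hv)]

variable {α : ℝ}

/-- The factor in the upper tail bound is eventually below `α`, so `stdValue ν x` lies in the
region, and all smaller positive values with it. -/
lemma eventually_lawS_Iic_le_limitFDR (hα0 : 0 < α) (hα : α ≤ 1 / 2) {x : ℝ} (hx0 : 0 < x)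
    (hx : Real.exp (-x ^ 2 / 2) < α) :
    ∀ᶠ ν in atTop, (lawS ν).real (Iic (stdValue ν x)) ≤ limitFDR α ν := by
  have hlim := (tendsto_exp_stdValue x).mul tendsto_integral_max
  rw [mul_one] at hlim
  filter_upwards [hlim.eventually_lt_const hx, eventually_gt_atTop 0,
    (tendsto_one_sub_div_sqrt_half x).eventually_const_lt one_pos,
    tendsto_integral_max.eventually_const_lt one_pos] with ν hlt hν hpos hI
  have := isProbabilityMeasure_lawS hν
  have hs : 0 < stdValue ν x := Real.sqrt_pos.2 hpos
  have hs1 : stdValue ν x < 1 := by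
    rw [stdValue, Real.sqrt_lt' one_pos]
    have : 0 < x / √(ν / 2) := by positivity
    linarith
  obtain ⟨c, hc, hle⟩ := exists_tTail_le_mul_normTail hν hs hs1 hI.ne'
  have hmem : tTail ν c < α * normTail (c * stdValue ν x) :=
    hle.trans_lt (mul_lt_mul_of_pos_right hlt (normTail_pos _))
  rw [limitFDR, measureReal_def, measureReal_def]
  refine ENNReal.toReal_mono (measure_ne_top _ _) (measure_mono_ae ?_)
  filter_upwards [lawS_ae_pos hν] with r hr hrs
  rcases (show r ≤ stdValue ν x from hrs).lt_or_eq with h | h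
  · exact mem_rejectionRegion_of_lt hν hα0 hα hr h hc hmem.le
  · exact ⟨hr, c, hc, h ▸ hmem⟩

/-- A point of the region beyond `stdValue ν x` would put `stdValue ν x` itself in it, against the
lower tail bound, whose factor eventually exceeds `α`. -/
lemma eventually_limitFDR_le_lawS_Iic (hα0 : 0 < α) (hα : α ≤ 1 / 2) {x : ℝ}
    (hx : α < Real.exp (-x ^ 2 / 2)) :
    ∀ᶠ ν in atTop, limitFDR α ν ≤ (lawS ν).real (Iic (stdValue ν x)) := by
  have hlim := (tendsto_exp_stdValue x).mul (tendsto_integral_min x)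
  rw [mul_one] at hlim
  filter_upwards [hlim.eventually_const_lt hx, eventually_gt_atTop 0,
    (tendsto_one_sub_div_sqrt_half x).eventually_const_lt one_pos] with ν hlt hν hpos
  have := isProbabilityMeasure_lawS hν
  have hs : 0 < stdValue ν x := Real.sqrt_pos.2 hpos
  refine measureReal_mono fun r hr => ?_
  by_contra hrs
  obtain ⟨_, c, hc, hlt'⟩ := hr
  obtain ⟨_, d, hd, hlt2⟩ := mem_rejectionRegion_of_lt hν hα0 hα hs (not_le.1 hrs) hc hlt'.le
  have h1 := mul_normTail_le_tTail hν hd hs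
  have h2 := mul_lt_mul_of_pos_right hlt (normTail_pos (d * stdValue ν x))
  linarith

lemma continuous_cdf_gaussianReal : Continuous (cdf (gaussianReal 0 1)) := by
  have h : (cdf (gaussianReal 0 1) : ℝ → ℝ) = fun x => 1 - normTail x := by
    ext x
    rw [cdf_eq_real, normTail, ← compl_Iic, probReal_compl_eq_one_sub measurableSet_Iic]
    ring
  rw [h]
  exact continuous_const.sub continuous_normTail

/-- At `x = z` one has `exp (-x ^ 2 / 2) = α`. Values of `x` on either side of `z` sandwich the
limit, and continuity of the normal c.d.f. closes the gap. -/
theorem tendsto_limitFDR (hα0 : 0 < α) (hα : α ≤ 1 / 2) :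
    Tendsto (limitFDR α) atTop (𝓝 (cdf (gaussianReal 0 1) (-√(-2 * Real.log α)))) := by
  have hlog : Real.log α < 0 := Real.log_neg hα0 (by linarith)
  set z := √(-2 * Real.log α) with hz
  have hz0 : 0 < z := Real.sqrt_pos.2 (by linarith)
  have hz2 : z ^ 2 = -2 * Real.log α := Real.sq_sqrt (by linarith)
  have hcont : Tendsto (fun x => cdf (gaussianReal 0 1) (-x)) (𝓝 z)
      (𝓝 (cdf (gaussianReal 0 1) (-z))) :=
    (continuous_cdf_gaussianReal.comp continuous_neg).tendsto z
  refine tendsto_order.2 ⟨fun b hb => ?_, fun b hb => ?_⟩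
  · obtain ⟨x, hxb, hxz⟩ := (((hcont.mono_left nhdsWithin_le_nhds).eventually_const_lt hb).and
      (self_mem_nhdsWithin (s := Ioi z))).exists
    have hxz : z < x := hxz
    have hx : Real.exp (-x ^ 2 / 2) < α := by
      rw [← Real.lt_log_iff_exp_lt hα0]
      nlinarith
    filter_upwards [eventually_lawS_Iic_le_limitFDR hα0 hα (hz0.trans hxz) hx,
      (tendsto_lawS_Iic_stdValue x).eventually_const_lt hxb] with ν h1 h2
    exact h2.trans_le h1
  · obtain ⟨x, ⟨hxb, hx0⟩, hxz⟩ := ((((hcont.mono_left nhdsWithin_le_nhds).eventually_lt_const hb).and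
      (nhdsWithin_le_nhds (lt_mem_nhds hz0))).and (self_mem_nhdsWithin (s := Iio z))).exists
    have hxz : x < z := hxz
    have hx : α < Real.exp (-x ^ 2 / 2) := by
      rw [← Real.log_lt_iff_lt_exp hα0]
      nlinarith
    filter_upwards [eventually_limitFDR_le_lawS_Iic hα0 hα hx,
      (tendsto_lawS_Iic_stdValue x).eventually_lt_const hxb] with ν h1 h2
    exact h1.trans_lt h2

end LargeDegreesOfFreedom

end

end StudentizedFDR

theorem theorem4p3 (α : ℝ) (hα0 : 0 < α) (hα : α ≤ 1 / 2) :
    ∃ FDRinf : ℝ → ℝ,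
      (∀ ν : ℝ, 0 < ν → StudentizedFDR.IsLimitingFDROne ν α (FDRinf ν)) ∧
      Tendsto FDRinf atTop (𝓝 (cdf (gaussianReal 0 1) (-√(-2 * Real.log α)))) := by
  exact ⟨StudentizedFDR.limitFDR α,
    fun _ hν => StudentizedFDR.isLimitingFDROne_limitFDR hν hα0 hα,
    StudentizedFDR.tendsto_limitFDR hα0 hα⟩
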